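/- **The calculus.** Fix a set of name sorts $k$, each with a set of name constants and a set of name variables; a name is a name constant or a name variable. Types are given by $T ::= \mathrm{proc} \mid T\to\mathrm{proc} \mid k\to\mathrm{proc}$ ($k$ a name sort), and each name sort $k$ carries terms of a fixed type $\mathrm{obj}(k)$. Terms (up to $\alpha$-conversion, possibly with free process variables $X$ and free name variables $x$) are the well-typed expressions $$P,Q ::= 0 \mid X \mid m(X).P \mid \overline m(Q) \mid P\,|\,Q \mid \langle X\rangle P \mid P\langle Q\rangle \mid \langle x\rangle P \mid P\langle n\rangle ,$$ where $0$, $m(X).P$, $\overline m(Q)$, $P|Q$, $P\langle Q\rangle$, $P\langle n\rangle$ have type $\mathrm{proc}$; the bodies of prefixes and abstractions and the components of $|$ have type $\mathrm{proc}$; $X$ in $m(X).P$ and $Q$ in $\overline m(Q)$ have the type carried by $m$; $\langle X\rangle P$ has type $T\to\mathrm{proc}$ for $X$ of type $T$ and is applied to terms of type $T$; $\langle x\rangle P$ has type $k\to\mathrm{proc}$ for $x$ of sort $k$ and is applied to names of sort $k$. Terms of the form $\langle X\rangle P$ or $\langle x\rangle P$ are called abstractions. Structural congruence $\equiv$ is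 the smallest congruence with the commutative monoid laws for $|$ and $0$, $(\langle X\rangle P)\langle Q\rangle\equiv P\{Q/X\}$ and $(\langle x\rangle P)\langle m\rangle\equiv P\{m/x\}$. Transitions are generated by $m(X).P\xrightarrow{m(X)}P$ and $\overline m(Q)\xrightarrow{\overline m(Q)}0$, closed under parallel composition (with the bound variable of the action not free in the other component) and under $\equiv$ on both sides. **Bisimilarity.** $\sim$ is the largest strong HO-IO bisimulation, that is, the largest symmetric relation $\mathcal R$ between terms of equal type such that $P\,\mathcal R\,Q$ implies: (1) if $P$ is not an abstraction, neither is $Q$; (2) if $P=\langle Y\rangle A$ then $Q=\langle Y\rangle B$ with $A\,\mathcal R\,B$; (3) if $P=\langle y\rangle A$ then $Q=\langle y\rangle B$ with $A\,\mathcal R\,B$; (4) if $P\xrightarrow{\overline m(A)}P'$ then $Q\xrightarrow{\overline m(B)}Q'$ with $A\,\mathcal R\,B$ and $P'\,\mathcal R\,Q'$; (5) if $P\xrightarrow{m(X)}P'$ then $Q\xrightarrow{m(X)}Q'$ with $P'\,\mathcal R\,Q'$; (6) if $P\equiv X|P'$ then $Q\equiv X|Q'$ with $P'\,\mathcal R\,Q'$,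 and, for $X$ of abstraction type, if $P=X$ then $Q\equiv X$; (7) if $P\equiv X\langle A\rangle|P'$ then $Q\equiv X\langle B\rangle|Q'$ with $A\,\mathcal R\,B$ and $P'\,\mathcal R\,Q'$; (8) if $P\equiv X\langle n\rangle|P'$ then $Q\equiv X\langle n\rangle|Q'$ with $P'\,\mathcal R\,Q'$. Here $m,n$ range over all names. **Axioms and normal forms.** The axiom system $\mathcal A$ consists of the commutative monoid laws for $|$ and $0$ and the laws $$(DIS)\;\; m(X).\Bigl(P\,|\,\prod_{1}^{k-1}m(X).P\Bigr)=\prod_{1}^{k}m(X).P\ \ (k\ge2),\quad (APP1)\;\;(\langle X\rangle P)\langle Q\rangle=P\{Q/X\},\quad (APP2)\;\;(\langle x\rangle P)\langle m\rangle=P\{m/x\}.$$ Write $\mathcal A\vdash P=Q$ if $P$ and $Q$ are related by the smallest congruence containing these laws. Write $P\rightsquigarrow Q$ if, up to the commutative monoid laws (applied anywhere in $P$ and $Q$), $Q$ arises from $P$ by rewriting one subterm by DIS, APP1 or APP2 from left to right. A term is in normal form if it has no $\rightsquigarrow$-step; a normal form of $P$ is a term $N$ in normal form with $P\rightsquigarrow^*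 N$. **Theorem (Completeness).** Let $P,Q$ be terms of the same type. Then: 1. $P$ has a normal form, unique up to $\equiv$; denote it by $\mathsf{nf}(P)$. 2. (Soundness) If $P\rightsquigarrow Q$ then $P\sim Q$; and $P\sim\mathsf{nf}(P)$. 3. (Completeness) If $P\sim Q$ then $\mathsf{nf}(P)\equiv\mathsf{nf}(Q)$; the converse holds as well. 4. Hence $P\sim Q$ if and only if $\mathcal A\vdash P=Q$. -/

import Mathlib

namespace HOmp

universe u

/-- Types of terms over a set `K` of name sorts. `proc`: non-abstractions (processes);
`pabs S`: process abstractions `⟨X⟩P` with `X` of type `S`; `nabs k`: name abstractions `⟨x⟩P` with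
`x` of sort `k`. The body of an abstraction is a process, as in Sangiorgi's typing of abstractions
(`T → ◇`). As `Ty` is inductive, every abstraction has finite order. -/
inductive Ty (K : Type u) : Type u
  | proc : Ty K
  | pabs : Ty K → Ty K
  | nabs : K → Ty K

/-- A sorting of names: name sorts, the type of the terms carried by channels of each sort
(recursion through name sorts is allowed), and the name constants of each sort. -/
structure Sorting where
  NSort : Type u
  obj : NSort → Ty NSort
  Const : NSort → Type u

/-- De Bruijn variables: positions in a context. -/
inductive Var {K : Type u} : List K → K → Type u
  | z {Γ : List K} {T : K} : Var (T :: Γ) T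
  | s {Γ : List K} {S T : K} : Var Γ T → Var (S :: Γ) T

/-- Names of sort `k`: name constants, and name variables declared in `Δ`. -/
inductive Name (σ : Sorting.{u}) (Δ : List σ.NSort) (k : σ.NSort) : Type u
  | const : σ.Const k → Name σ Δ k
  | var : Var Δ k → Name σ Δ k

/-- Well-formed terms (up to α-conversion) of a given type, with free process variables in `Γ` and
free name variables in `Δ`. -/
inductive Tm (σ : Sorting.{u}) :
    List (Ty σ.NSort) → List σ.NSort → Ty σ.NSort → Type u
  /-- `0` -/
  | nil {Γ : List (Ty σ.NSort)} {Δ : List σ.NSort} : Tm σ Γ Δ .proc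
  /-- `X` -/
  | var {Γ : List (Ty σ.NSort)} {Δ : List σ.NSort} {T : Ty σ.NSort} : Var Γ T → Tm σ Γ Δ T
  /-- `m(X).P` -/
  | inp {Γ : List (Ty σ.NSort)} {Δ : List σ.NSort} {k : σ.NSort} :
      Name σ Δ k → Tm σ (σ.obj k :: Γ) Δ .proc → Tm σ Γ Δ .proc
  /-- the output of `Q` on `m` -/
  | out {Γ : List (Ty σ.NSort)} {Δ : List σ.NSort} {k : σ.NSort} :
      Name σ Δ k → Tm σ Γ Δ (σ.obj k) → Tm σ Γ Δ .proc
  /-- `P | Q` -/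
  | par {Γ : List (Ty σ.NSort)} {Δ : List σ.NSort} :
      Tm σ Γ Δ .proc → Tm σ Γ Δ .proc → Tm σ Γ Δ .proc
  /-- `⟨X⟩P` -/
  | pabs {Γ : List (Ty σ.NSort)} {Δ : List σ.NSort} {S : Ty σ.NSort} :
      Tm σ (S :: Γ) Δ .proc → Tm σ Γ Δ (.pabs S)
  /-- `P⟨Q⟩` -/
  | papp {Γ : List (Ty σ.NSort)} {Δ : List σ.NSort} {S : Ty σ.NSort} :
      Tm σ Γ Δ (.pabs S) → Tm σ Γ Δ S → Tm σ Γ Δ .proc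
  /-- `⟨x⟩P` -/
  | nabs {Γ : List (Ty σ.NSort)} {Δ : List σ.NSort} {k : σ.NSort} :
      Tm σ Γ (k :: Δ) .proc → Tm σ Γ Δ (.nabs k)
  /-- `P⟨n⟩` -/
  | napp {Γ : List (Ty σ.NSort)} {Δ : List σ.NSort} {k : σ.NSort} :
      Tm σ Γ Δ (.nabs k) → Name σ Δ k → Tm σ Γ Δ .proc

section Substitution

variable {σ : Sorting.{u}} {Γ Γ' : List (Ty σ.NSort)} {Δ Δ' : List σ.NSort}

/-- Renamings of process variables. -/
abbrev PRen (σ : Sorting.{u}) (Γ Γ' : List (Ty σ.NSort)) : Type u :=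
  ∀ ⦃T : Ty σ.NSort⦄, Var Γ T → Var Γ' T

/-- Simultaneous substitutions of names for name variables. -/
abbrev NSub (σ : Sorting.{u}) (Δ Δ' : List σ.NSort) : Type u :=
  ∀ ⦃k : σ.NSort⦄, Var Δ k → Name σ Δ' k

/-- Simultaneous substitutions of terms for process variables. -/
abbrev PSub (σ : Sorting.{u}) (Γ Γ' : List (Ty σ.NSort)) (Δ : List σ.NSort) : Type u :=
  ∀ ⦃T : Ty σ.NSort⦄, Var Γ T → Tm σ Γ' Δ T

def PRen.lift (ρ : PRen σ Γ Γ') {S : Ty σ.NSort} : PRen σ (S :: Γ) (S :: Γ')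
  | _, .z => .z
  | _, .s x => .s (ρ x)

def Name.sub (ν : NSub σ Δ Δ') {k : σ.NSort} : Name σ Δ k → Name σ Δ' k
  | .const c => .const c
  | .var x => ν x

/-- Weakening of the name context by one variable. -/
def NSub.wk {k : σ.NSort} : NSub σ Δ (k :: Δ) := fun _ x => .var (.s x)

def NSub.lift (ν : NSub σ Δ Δ') {k : σ.NSort} : NSub σ (k :: Δ) (k :: Δ')
  | _, .z => .var .z
  | _, .s x => (ν x).sub NSub.wk

/-- Renames process variables by `ρ` and substitutes names for name variables by `ν`. -/
def Tm.ren {Γ : List (Ty σ.NSort)} {Δ : List σ.NSort} {T : Ty σ.NSort} (P : Tm σ Γ Δ T)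
    {Γ' : List (Ty σ.NSort)} {Δ' : List σ.NSort} (ρ : PRen σ Γ Γ') (ν : NSub σ Δ Δ') :
    Tm σ Γ' Δ' T :=
  match P with
  | .nil => .nil
  | .var x => .var (ρ x)
  | .inp m P => .inp (m.sub ν) (P.ren (PRen.lift ρ) ν)
  | .out m Q => .out (m.sub ν) (Q.ren ρ ν)
  | .par P Q => .par (P.ren ρ ν) (Q.ren ρ ν)
  | .pabs P => .pabs (P.ren (PRen.lift ρ) ν)
  | .papp P Q => .papp (P.ren ρ ν) (Q.ren ρ ν)
  | .nabs P => .nabs (P.ren ρ (NSub.lift ν))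
  | .napp P n => .napp (P.ren ρ ν) (n.sub ν)

/-- `P` in a context with one more process variable, which does not occur in `P`. -/
def Tm.wkP {T S : Ty σ.NSort} (P : Tm σ Γ Δ T) : Tm σ (S :: Γ) Δ T :=
  P.ren (fun _ x => .s x) (fun _ x => .var x)

/-- `P` in a context with one more name variable, which does not occur in `P`. -/
def Tm.wkN {T : Ty σ.NSort} {k : σ.NSort} (P : Tm σ Γ Δ T) : Tm σ Γ (k :: Δ) T :=
  P.ren (fun _ x => x) NSub.wk

def PSub.liftP (θ : PSub σ Γ Γ' Δ) {S : Ty σ.NSort} : PSub σ (S :: Γ) (S :: Γ') Δ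
  | _, .z => .var .z
  | _, .s x => (θ x).wkP

def PSub.liftN (θ : PSub σ Γ Γ' Δ) {k : σ.NSort} : PSub σ Γ Γ' (k :: Δ) :=
  fun _ x => (θ x).wkN

/-- Capture-avoiding simultaneous substitution of terms for process variables. -/
def Tm.sub {Γ : List (Ty σ.NSort)} {Δ : List σ.NSort} {T : Ty σ.NSort} (P : Tm σ Γ Δ T)
    {Γ' : List (Ty σ.NSort)} (θ : PSub σ Γ Γ' Δ) : Tm σ Γ' Δ T :=
  match P with
  | .nil => .nil
  | .var x => θ x
  | .inp m P => .inp m (P.sub (PSub.liftP θ))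
  | .out m Q => .out m (Q.sub θ)
  | .par P Q => .par (P.sub θ) (Q.sub θ)
  | .pabs P => .pabs (P.sub (PSub.liftP θ))
  | .papp P Q => .papp (P.sub θ) (Q.sub θ)
  | .nabs P => .nabs (P.sub (PSub.liftN θ))
  | .napp P n => .napp (P.sub θ) n

def PSub.single {S : Ty σ.NSort} (Q : Tm σ Γ Δ S) : PSub σ (S :: Γ) Γ Δ
  | _, .z => Q
  | _, .s x => .var x

def NSub.single {k : σ.NSort} (m : Name σ Δ k) : NSub σ (k :: Δ) Δ
  | _, .z => m
  | _, .s x => .var x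

/-- `P{Q/X}`, where `X` is the most recent process variable. -/
def Tm.psubst {S T : Ty σ.NSort} (P : Tm σ (S :: Γ) Δ T) (Q : Tm σ Γ Δ S) : Tm σ Γ Δ T :=
  P.sub (PSub.single Q)

/-- `P{m/x}`, where `x` is the most recent name variable. -/
def Tm.nsubst {T : Ty σ.NSort} {k : σ.NSort} (P : Tm σ Γ (k :: Δ) T) (m : Name σ Δ k) :
    Tm σ Γ Δ T :=
  P.ren (fun _ x => x) (NSub.single m)

/-- The parallel composition of `n` copies of `P` (`0` if `n = 0`). -/
def Tm.copies : ℕ → Tm σ Γ Δ .proc → Tm σ Γ Δ .proc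
  | 0, _ => .nil
  | n + 1, P => .par P (Tm.copies n P)

/-- `P` has the form `⟨X⟩A` or `⟨x⟩A`. -/
def Tm.IsAbs {T : Ty σ.NSort} : Tm σ Γ Δ T → Prop
  | .pabs _ => True
  | .nabs _ => True
  | _ => False

end Substitution

/-- Binary relations on terms. They relate terms of the same type in the same context. -/
abbrev TRel (σ : Sorting.{u}) : Type u :=
  ∀ ⦃Γ : List (Ty σ.NSort)⦄ ⦃Δ : List σ.NSort⦄ ⦃T : Ty σ.NSort⦄, Tm σ Γ Δ T → Tm σ Γ Δ T → Prop

section Laws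

variable {σ : Sorting.{u}}

/-- The commutative monoid laws for parallel composition. -/
inductive MonoidLaw : TRel σ
  | assoc {Γ Δ} (P Q R : Tm σ Γ Δ .proc) : MonoidLaw (.par (.par P Q) R) (.par P (.par Q R))
  | comm {Γ Δ} (P Q : Tm σ Γ Δ .proc) : MonoidLaw (.par P Q) (.par Q P)
  | unit {Γ Δ} (P : Tm σ Γ Δ .proc) : MonoidLaw (.par P .nil) P

/-- The application laws: `(⟨X⟩P)⟨Q⟩ = P{Q/X}` and `(⟨x⟩P)⟨m⟩ = P{m/x}`. -/
inductive AppLaw : TRel σ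
  | app1 {Γ Δ S} (P : Tm σ (S :: Γ) Δ .proc) (Q : Tm σ Γ Δ S) :
      AppLaw (.papp (.pabs P) Q) (P.psubst Q)
  | app2 {Γ Δ k} (P : Tm σ Γ (k :: Δ) .proc) (m : Name σ Δ k) :
      AppLaw (.napp (.nabs P) m) (P.nsubst m)

/-- The distribution law `m(X).(P | ∏_{1}^{k-1} m(X).P) = ∏_{1}^{k} m(X).P`, for `k ≥ 2` (for
`k = 1` both sides agree). The inner copies of `m(X).P` rebind `X`, so they are weakened. -/
inductive DisLaw : TRel σ
  | dis {Γ Δ} {s : σ.NSort} (m : Name σ Δ s) (P : Tm σ (σ.obj s :: Γ) Δ .proc) (k : ℕ)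
      (hk : 2 ≤ k) :
      DisLaw (.inp m (.par P (Tm.copies (k - 1) (Tm.inp m P).wkP))) (Tm.copies k (.inp m P))

/-- The smallest congruence containing `B`. -/
inductive Cong (B : TRel σ) : TRel σ
  | base {Γ Δ T} {P Q : Tm σ Γ Δ T} : B P Q → Cong B P Q
  | refl {Γ Δ T} (P : Tm σ Γ Δ T) : Cong B P P
  | symm {Γ Δ T} {P Q : Tm σ Γ Δ T} : Cong B P Q → Cong B Q P
  | trans {Γ Δ T} {P Q R : Tm σ Γ Δ T} : Cong B P Q → Cong B Q R → Cong B P R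
  | inp {Γ Δ} {k : σ.NSort} (m : Name σ Δ k) {P Q : Tm σ (σ.obj k :: Γ) Δ .proc} :
      Cong B P Q → Cong B (.inp m P) (.inp m Q)
  | out {Γ Δ} {k : σ.NSort} (m : Name σ Δ k) {P Q : Tm σ Γ Δ (σ.obj k)} :
      Cong B P Q → Cong B (.out m P) (.out m Q)
  | par {Γ Δ} {P P' Q Q' : Tm σ Γ Δ .proc} :
      Cong B P P' → Cong B Q Q' → Cong B (.par P Q) (.par P' Q')
  | pabs {Γ Δ S} {P Q : Tm σ (S :: Γ) Δ .proc} : Cong B P Q → Cong B (.pabs P) (.pabs Q)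
  | papp {Γ Δ S} {P P' : Tm σ Γ Δ (.pabs S)} {Q Q' : Tm σ Γ Δ S} :
      Cong B P P' → Cong B Q Q' → Cong B (.papp P Q) (.papp P' Q')
  | nabs {Γ Δ k} {P Q : Tm σ Γ (k :: Δ) .proc} : Cong B P Q → Cong B (.nabs P) (.nabs Q)
  | napp {Γ Δ k} {P P' : Tm σ Γ Δ (.nabs k)} (n : Name σ Δ k) :
      Cong B P P' → Cong B (.napp P n) (.napp P' n)

/-- `InSubterm B P Q`: `Q` is obtained from `P` by rewriting one subterm along `B`. -/
inductive InSubterm (B : TRel σ) : TRel σ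
  | here {Γ Δ T} {P Q : Tm σ Γ Δ T} : B P Q → InSubterm B P Q
  | inp {Γ Δ} {k : σ.NSort} (m : Name σ Δ k) {P Q : Tm σ (σ.obj k :: Γ) Δ .proc} :
      InSubterm B P Q → InSubterm B (.inp m P) (.inp m Q)
  | out {Γ Δ} {k : σ.NSort} (m : Name σ Δ k) {P Q : Tm σ Γ Δ (σ.obj k)} :
      InSubterm B P Q → InSubterm B (.out m P) (.out m Q)
  | parL {Γ Δ} {P P' : Tm σ Γ Δ .proc} (Q : Tm σ Γ Δ .proc) :
      InSubterm B P P' → InSubterm B (.par P Q) (.par P' Q)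
  | parR {Γ Δ} (P : Tm σ Γ Δ .proc) {Q Q' : Tm σ Γ Δ .proc} :
      InSubterm B Q Q' → InSubterm B (.par P Q) (.par P Q')
  | pabs {Γ Δ S} {P Q : Tm σ (S :: Γ) Δ .proc} :
      InSubterm B P Q → InSubterm B (.pabs P) (.pabs Q)
  | pappL {Γ Δ S} {P P' : Tm σ Γ Δ (.pabs S)} (Q : Tm σ Γ Δ S) :
      InSubterm B P P' → InSubterm B (.papp P Q) (.papp P' Q)
  | pappR {Γ Δ S} (P : Tm σ Γ Δ (.pabs S)) {Q Q' : Tm σ Γ Δ S} :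
      InSubterm B Q Q' → InSubterm B (.papp P Q) (.papp P Q')
  | nabs {Γ Δ k} {P Q : Tm σ Γ (k :: Δ) .proc} :
      InSubterm B P Q → InSubterm B (.nabs P) (.nabs Q)
  | napp {Γ Δ k} {P P' : Tm σ Γ Δ (.nabs k)} (n : Name σ Δ k) :
      InSubterm B P P' → InSubterm B (.napp P n) (.napp P' n)

/-- Structural congruence `≡`: the smallest congruence with the commutative monoid laws for
parallel composition and the application laws. -/
def SCongr : TRel σ := Cong fun _ _ _ P Q => MonoidLaw P Q ∨ AppLaw P Q

/-- The congruence generated by the commutative monoid laws alone. -/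
def MCongr : TRel σ := Cong MonoidLaw

/-- Provable equality in the axiom system: the commutative monoid laws, `DIS`, `APP1`, `APP2`. -/
def AxEq : TRel σ := Cong fun _ _ _ P Q => MonoidLaw P Q ∨ DisLaw P Q ∨ AppLaw P Q

/-- `P ⇝ Q`: up to the monoid laws, `Q` is obtained from `P` by rewriting a subterm by `DIS`,
`APP1` or `APP2` from left to right. -/
def Rewrites : TRel σ := fun Γ Δ T P Q =>
  ∃ P' Q' : Tm σ Γ Δ T, MCongr P P' ∧
    InSubterm (fun _ _ _ A B => DisLaw A B ∨ AppLaw A B) P' Q' ∧ MCongr Q' Q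

/-- `P` is in normal form: no `⇝`-step is possible. -/
def IsNormal {Γ Δ T} (P : Tm σ Γ Δ T) : Prop := ∀ Q : Tm σ Γ Δ T, ¬ Rewrites P Q

/-- `N` is a normal form of `P`. -/
def NormalFormOf {Γ Δ T} (N P : Tm σ Γ Δ T) : Prop :=
  Relation.ReflTransGen (fun A B : Tm σ Γ Δ T => Rewrites A B) P N ∧ IsNormal N

end Laws

section Bisimilarity

variable {σ : Sorting.{u}}

/-- Output transitions: `OutTr m A P P'` says that `P` outputs `A` on `m` and becomes `P'`. -/
inductive OutTr {Γ : List (Ty σ.NSort)} {Δ : List σ.NSort} {k : σ.NSort}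
    (m : Name σ Δ k) (A : Tm σ Γ Δ (σ.obj k)) : Tm σ Γ Δ .proc → Tm σ Γ Δ .proc → Prop
  | out : OutTr m A (.out m A) .nil
  | parL {P P'} (Q : Tm σ Γ Δ .proc) : OutTr m A P P' → OutTr m A (.par P Q) (.par P' Q)
  | parR {Q Q'} (P : Tm σ Γ Δ .proc) : OutTr m A Q Q' → OutTr m A (.par P Q) (.par P Q')
  | struct {Q P P' Q'} : SCongr Q P → OutTr m A P P' → SCongr P' Q' → OutTr m A Q Q'

/-- Input transitions (late style): `InpTr m P P'` says that `P` inputs on `m` and becomes `P'`, in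
which the most recent process variable is the place-holder `X`. Weakening in the rules for parallel
composition is the condition that `X` is not free in the other component. -/
inductive InpTr {Γ : List (Ty σ.NSort)} {Δ : List σ.NSort} {k : σ.NSort}
    (m : Name σ Δ k) : Tm σ Γ Δ .proc → Tm σ (σ.obj k :: Γ) Δ .proc → Prop
  | inp (P : Tm σ (σ.obj k :: Γ) Δ .proc) : InpTr m (.inp m P) P
  | parL {P P'} (Q : Tm σ Γ Δ .proc) : InpTr m P P' → InpTr m (.par P Q) (.par P' Q.wkP)
  | parR {Q Q'} (P : Tm σ Γ Δ .proc) : InpTr m Q Q' → InpTr m (.par P Q) (.par P.wkP Q')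
  | struct {Q P P' Q'} : SCongr Q P → InpTr m P P' → SCongr P' Q' → InpTr m Q Q'

/-- Strong HO-IO bisimulations. Interaction (`τ`) transitions play no role in this notion. -/
structure IsHOIOBisim (R : TRel σ) : Prop where
  symm : ∀ {Γ Δ T} {P Q : Tm σ Γ Δ T}, R P Q → R Q P
  nonabs : ∀ {Γ Δ T} {P Q : Tm σ Γ Δ T}, R P Q → ¬ P.IsAbs → ¬ Q.IsAbs
  pabs : ∀ {Γ Δ S} {A : Tm σ (S :: Γ) Δ .proc} {Q : Tm σ Γ Δ (.pabs S)}, R (.pabs A) Q →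
    ∃ B, Q = .pabs B ∧ R A B
  nabs : ∀ {Γ Δ k} {A : Tm σ Γ (k :: Δ) .proc} {Q : Tm σ Γ Δ (.nabs k)}, R (.nabs A) Q →
    ∃ B, Q = .nabs B ∧ R A B
  out : ∀ {Γ Δ} {P Q : Tm σ Γ Δ .proc}, R P Q →
    ∀ {k} (m : Name σ Δ k) (A : Tm σ Γ Δ (σ.obj k)) (P' : Tm σ Γ Δ .proc), OutTr m A P P' →
      ∃ B Q', OutTr m B Q Q' ∧ R A B ∧ R P' Q'
  inp : ∀ {Γ Δ} {P Q : Tm σ Γ Δ .proc}, R P Q →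
    ∀ {k} (m : Name σ Δ k) (P' : Tm σ (σ.obj k :: Γ) Δ .proc), InpTr m P P' →
      ∃ Q', InpTr m Q Q' ∧ R P' Q'
  var : ∀ {Γ Δ} {P Q : Tm σ Γ Δ .proc}, R P Q →
    ∀ (X : Var Γ .proc) (P' : Tm σ Γ Δ .proc), SCongr P (.par (.var X) P') →
      ∃ Q', SCongr Q (.par (.var X) Q') ∧ R P' Q'
  /-- The previous clause for a variable `X` of abstraction type: `X` has no parallel component
  but the implicit `0`, and it is matched by `X`. -/
  varAbs : ∀ {Γ Δ T} (X : Var Γ T) {Q : Tm σ Γ Δ T}, T ≠ .proc → R (.var X) Q → SCongr Q (.var X)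
  varPapp : ∀ {Γ Δ} {P Q : Tm σ Γ Δ .proc}, R P Q →
    ∀ {S} (X : Var Γ (.pabs S)) (A : Tm σ Γ Δ S) (P' : Tm σ Γ Δ .proc),
      SCongr P (.par (.papp (.var X) A) P') →
        ∃ B Q', SCongr Q (.par (.papp (.var X) B) Q') ∧ R A B ∧ R P' Q'
  varNapp : ∀ {Γ Δ} {P Q : Tm σ Γ Δ .proc}, R P Q →
    ∀ {k} (X : Var Γ (.nabs k)) (n : Name σ Δ k) (P' : Tm σ Γ Δ .proc),
      SCongr P (.par (.napp (.var X) n) P') →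
        ∃ Q', SCongr Q (.par (.napp (.var X) n) Q') ∧ R P' Q'

/-- Strong bisimilarity `∼`: the largest strong HO-IO bisimulation. -/
def Bisim : TRel σ := fun _ _ _ P Q => ∃ R : TRel σ, IsHOIOBisim R ∧ R P Q

end Bisimilarity

end HOmp

namespace HOmp

universe u

/-! ### Fusion laws for substitution -/

section SubstitutionAlgebra

variable {σ : Sorting.{u}}

/-! The application laws are separated from the rest. Every term reduces to a unique beta-normal
form `Tm.bnf`: existence is a hereditary substitution argument on the depth of types
(`Tm.BetaNormal.exists_sub`), and uniqueness holds because iterated complete developments eventually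
reach any normal form (`AppSteps.exists_dev_iterate`). Complete development also preserves
congruences generated by the monoid laws, with or without DIS. Hence `≡` and provable equality
become, on beta-normal forms, congruences that no longer mention application (`Cong.bnf_of_appLaw`).

On beta-normal forms, transitions and the variable clauses of bisimulation are statements about
prime parallel factors. A congruence matches prime factors (`Cong.factorSim`); for inputs it is the
processes reached after the input that are related, and in this form DIS respects the matching. So
provable equality is a bisimulation, which is soundness.

For completeness, `Bisim.mCongr` shows by induction on size that bisimilar normal terms are equal up
to the monoid laws. A factor that is not an input is matched by one of the same shape, and the
induction hypothesis applies to its components and to the remainder. If all factors are inputs, the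
induction hypothesis applies to the processes reached, and a counting argument on multisets of
prefixes remains (`Sim.eq_or_expands`). Take a component F of maximal size on either side; it cannot
occur in the body of any component. If F is equally frequent on both sides, cancelling one
occurrence gives equality. Otherwise one side is F alone, the other consists of at least two copies
of a single prefix G, and the body of F is the body of G in parallel with all copies of G but one.
Then F is a DIS redex, against normality.

Normal forms exist because DIS decreases `Tm.weight` and creates no application redex, so it
suffices to beta-normalize first. No confluence argument for DIS is needed: two normal forms of a
term are provably equal, hence bisimilar, hence congruent. -/

theorem Name.sub_id {Δ : List σ.NSort} {k : σ.NSort} (m : Name σ Δ k) :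
    m.sub (fun _ x => .var x) = m := by
  cases m <;> rfl

theorem Name.sub_sub {Δ Δ' Δ'' : List σ.NSort} {k : σ.NSort} (m : Name σ Δ k) (ν : NSub σ Δ Δ')
    (ν' : NSub σ Δ' Δ'') : (m.sub ν).sub ν' = m.sub (fun _ x => (ν x).sub ν') := by
  cases m <;> rfl

theorem NSub.lift_id {Δ : List σ.NSort} {k : σ.NSort} :
    NSub.lift (σ := σ) (k := k) (fun _ (x : Var Δ _) => .var x) = fun _ x => .var x := by
  funext _ x; cases x <;> rfl

theorem NSub.lift_comp {Δ Δ' Δ'' : List σ.NSort} {k : σ.NSort} (ν : NSub σ Δ Δ')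
    (ν' : NSub σ Δ' Δ'') :
    (fun _ x => ((NSub.lift ν (k := k)) x).sub (NSub.lift ν' (k := k))) =
      NSub.lift (k := k) (fun _ x => (ν x).sub ν') := by
  funext _ x
  cases x with
  | z => rfl
  | s x =>
    simp only [NSub.lift, Name.sub_sub]
    rfl

theorem PRen.lift_comp {Γ Γ' Γ'' : List (Ty σ.NSort)} {S : Ty σ.NSort} (ρ : PRen σ Γ Γ')
    (ρ' : PRen σ Γ' Γ'') :
    (fun _ x => (PRen.lift ρ' (S := S)) ((PRen.lift ρ (S := S)) x)) =
      PRen.lift (S := S) (fun _ x => ρ' (ρ x)) := by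
  funext _ x; cases x <;> rfl

theorem PRen.lift_id {Γ : List (Ty σ.NSort)} {S : Ty σ.NSort} :
    PRen.lift (S := S) (fun _ (x : Var Γ _) => x) = fun _ x => x := by
  funext _ x; cases x <;> rfl

theorem Tm.ren_id {Γ : List (Ty σ.NSort)} {Δ : List σ.NSort} {T : Ty σ.NSort} (P : Tm σ Γ Δ T) :
    P.ren (fun _ x => x) (fun _ x => .var x) = P := by
  induction P with
  | nil => rfl
  | var x => rfl
  | inp m P ih => simp only [Tm.ren, Name.sub_id, ih, PRen.lift_id]
  | out m Q ih => simp only [Tm.ren, Name.sub_id, ih]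
  | par P Q ihP ihQ => simp only [Tm.ren, ihP, ihQ]
  | pabs P ih => simp only [Tm.ren, ih, PRen.lift_id]
  | papp P Q ihP ihQ => simp only [Tm.ren, ihP, ihQ]
  | nabs P ih => simp only [Tm.ren, ih, NSub.lift_id]
  | napp P n ih => simp only [Tm.ren, Name.sub_id, ih]

/-- Lifting a substitution under a binder renames its values. The fusion laws are therefore built up
in the order renaming after renaming, substitution after renaming, renaming after substitution, and
finally substitution after substitution. -/
theorem Tm.ren_ren {Γ : List (Ty σ.NSort)} {Δ : List σ.NSort} {T : Ty σ.NSort} (P : Tm σ Γ Δ T)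
    {Γ' Γ'' : List (Ty σ.NSort)} {Δ' Δ'' : List σ.NSort} (ρ : PRen σ Γ Γ') (ν : NSub σ Δ Δ')
    (ρ' : PRen σ Γ' Γ'') (ν' : NSub σ Δ' Δ'') :
    (P.ren ρ ν).ren ρ' ν' = P.ren (fun _ x => ρ' (ρ x)) (fun _ x => (ν x).sub ν') := by
  induction P generalizing Γ' Γ'' Δ' Δ'' with
  | nil => rfl
  | var x => rfl
  | inp m P ih => simp only [Tm.ren, Name.sub_sub, ih]; rw [PRen.lift_comp]
  | out m Q ih => simp only [Tm.ren, Name.sub_sub, ih]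
  | par P Q ihP ihQ => simp only [Tm.ren, ihP, ihQ]
  | pabs P ih => simp only [Tm.ren, ih]; rw [PRen.lift_comp]
  | papp P Q ihP ihQ => simp only [Tm.ren, ihP, ihQ]
  | nabs P ih => simp only [Tm.ren, ih]; rw [NSub.lift_comp]
  | napp P n ih => simp only [Tm.ren, Name.sub_sub, ih]

/-- Simultaneous substitution of terms for process variables and of names for name variables. -/
def Tm.msub {Γ : List (Ty σ.NSort)} {Δ : List σ.NSort} {T : Ty σ.NSort} (P : Tm σ Γ Δ T)
    {Γ' : List (Ty σ.NSort)} {Δ' : List σ.NSort} (θ : PSub σ Γ Γ' Δ') (ν : NSub σ Δ Δ') :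
    Tm σ Γ' Δ' T :=
  match P with
  | .nil => .nil
  | .var x => θ x
  | .inp m P => .inp (m.sub ν) (P.msub (PSub.liftP θ) ν)
  | .out m Q => .out (m.sub ν) (Q.msub θ ν)
  | .par P Q => .par (P.msub θ ν) (Q.msub θ ν)
  | .pabs P => .pabs (P.msub (PSub.liftP θ) ν)
  | .papp P Q => .papp (P.msub θ ν) (Q.msub θ ν)
  | .nabs P => .nabs (P.msub (PSub.liftN θ) (NSub.lift ν))
  | .napp P n => .napp (P.msub θ ν) (n.sub ν)

theorem PSub.liftP_var {Γ Γ' : List (Ty σ.NSort)} {Δ : List σ.NSort} {S : Ty σ.NSort}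
    (ρ : PRen σ Γ Γ') :
    PSub.liftP (S := S) (fun _ x => Tm.var (Δ := Δ) (ρ x)) = fun _ x => .var (PRen.lift ρ x) := by
  funext _ x; cases x <;> rfl

/-- With `Tm.ren_eq_msub`, this reduces the contracta of both application laws to instances of one
operation, so that `Tm.msub_msub` covers all their interactions. -/
theorem Tm.sub_eq_msub {Γ : List (Ty σ.NSort)} {Δ : List σ.NSort} {T : Ty σ.NSort} (P : Tm σ Γ Δ T)
    {Γ' : List (Ty σ.NSort)} (θ : PSub σ Γ Γ' Δ) : P.sub θ = P.msub θ (fun _ x => .var x) := by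
  induction P generalizing Γ' with
  | nil => rfl
  | var x => rfl
  | inp m P ih => simp only [Tm.sub, Tm.msub, Name.sub_id, ih]
  | out m Q ih => simp only [Tm.sub, Tm.msub, Name.sub_id, ih]
  | par P Q ihP ihQ => simp only [Tm.sub, Tm.msub, ihP, ihQ]
  | pabs P ih => simp only [Tm.sub, Tm.msub, ih]
  | papp P Q ihP ihQ => simp only [Tm.sub, Tm.msub, ihP, ihQ]
  | nabs P ih => simp only [Tm.sub, Tm.msub, ih, NSub.lift_id]
  | napp P n ih => simp only [Tm.sub, Tm.msub, Name.sub_id, ih]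

theorem Tm.ren_eq_msub {Γ : List (Ty σ.NSort)} {Δ : List σ.NSort} {T : Ty σ.NSort} (P : Tm σ Γ Δ T)
    {Γ' : List (Ty σ.NSort)} {Δ' : List σ.NSort} (ρ : PRen σ Γ Γ') (ν : NSub σ Δ Δ') :
    P.ren ρ ν = P.msub (fun _ x => .var (ρ x)) ν := by
  induction P generalizing Γ' Δ' with
  | nil => rfl
  | var x => rfl
  | inp m P ih => simp only [Tm.ren, Tm.msub, ih, PSub.liftP_var]
  | out m Q ih => simp only [Tm.ren, Tm.msub, ih]
  | par P Q ihP ihQ => simp only [Tm.ren, Tm.msub, ihP, ihQ]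
  | pabs P ih => simp only [Tm.ren, Tm.msub, ih, PSub.liftP_var]
  | papp P Q ihP ihQ => simp only [Tm.ren, Tm.msub, ihP, ihQ]
  | nabs P ih => simp only [Tm.ren, Tm.msub, ih]; rfl
  | napp P n ih => simp only [Tm.ren, Tm.msub, ih]

theorem PRen.lift_liftP {Γ Γ' Γ'' : List (Ty σ.NSort)} {Δ : List σ.NSort} {S : Ty σ.NSort}
    (ρ : PRen σ Γ Γ') (θ : PSub σ Γ' Γ'' Δ) :
    (fun _ x => PSub.liftP (S := S) θ (PRen.lift ρ x)) = PSub.liftP (fun _ x => θ (ρ x)) := by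
  funext _ x; cases x <;> rfl

theorem Tm.msub_ren {Γ : List (Ty σ.NSort)} {Δ : List σ.NSort} {T : Ty σ.NSort} (P : Tm σ Γ Δ T)
    {Γ' Γ'' : List (Ty σ.NSort)} {Δ' Δ'' : List σ.NSort} (ρ : PRen σ Γ Γ') (ν : NSub σ Δ Δ')
    (θ : PSub σ Γ' Γ'' Δ'') (ν' : NSub σ Δ' Δ'') :
    (P.ren ρ ν).msub θ ν' = P.msub (fun _ x => θ (ρ x)) (fun _ x => (ν x).sub ν') := by
  induction P generalizing Γ' Γ'' Δ' Δ'' with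
  | nil => rfl
  | var x => rfl
  | inp m P ih => simp only [Tm.ren, Tm.msub, Name.sub_sub, ih]; rw [PRen.lift_liftP]
  | out m Q ih => simp only [Tm.ren, Tm.msub, Name.sub_sub, ih]
  | par P Q ihP ihQ => simp only [Tm.ren, Tm.msub, ihP, ihQ]
  | pabs P ih => simp only [Tm.ren, Tm.msub, ih]; rw [PRen.lift_liftP]
  | papp P Q ihP ihQ => simp only [Tm.ren, Tm.msub, ihP, ihQ]
  | nabs P ih => simp only [Tm.ren, Tm.msub, ih]; rw [NSub.lift_comp]; rfl
  | napp P n ih => simp only [Tm.ren, Tm.msub, Name.sub_sub, ih]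

theorem PSub.liftP_ren {Γ Γ' Γ'' : List (Ty σ.NSort)} {Δ Δ' : List σ.NSort} {S : Ty σ.NSort}
    (θ : PSub σ Γ Γ' Δ) (ρ : PRen σ Γ' Γ'') (ν : NSub σ Δ Δ') :
    (fun _ x => (PSub.liftP (S := S) θ x).ren (PRen.lift ρ) ν) =
      PSub.liftP (fun _ x => (θ x).ren ρ ν) := by
  funext _ x
  cases x with
  | z => rfl
  | s x => simp only [PSub.liftP, Tm.wkP, Tm.ren_ren]; congr; funext _ x; exact (Name.sub_id _).symm

theorem PSub.liftN_ren {Γ Γ' Γ'' : List (Ty σ.NSort)} {Δ Δ' : List σ.NSort} {k : σ.NSort}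
    (θ : PSub σ Γ Γ' Δ) (ρ : PRen σ Γ' Γ'') (ν : NSub σ Δ Δ') :
    (fun _ x => (PSub.liftN (k := k) θ x).ren ρ (NSub.lift ν)) =
      PSub.liftN (fun _ x => (θ x).ren ρ ν) := by
  funext _ x
  simp only [PSub.liftN, Tm.wkN, Tm.ren_ren]
  rfl

theorem Tm.ren_msub {Γ : List (Ty σ.NSort)} {Δ : List σ.NSort} {T : Ty σ.NSort} (P : Tm σ Γ Δ T)
    {Γ' Γ'' : List (Ty σ.NSort)} {Δ' Δ'' : List σ.NSort} (θ : PSub σ Γ Γ' Δ') (ν : NSub σ Δ Δ')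
    (ρ : PRen σ Γ' Γ'') (ν' : NSub σ Δ' Δ'') :
    (P.msub θ ν).ren ρ ν' = P.msub (fun _ x => (θ x).ren ρ ν') (fun _ x => (ν x).sub ν') := by
  induction P generalizing Γ' Γ'' Δ' Δ'' with
  | nil => rfl
  | var x => rfl
  | inp m P ih => simp only [Tm.ren, Tm.msub, Name.sub_sub, ih]; rw [PSub.liftP_ren]
  | out m Q ih => simp only [Tm.ren, Tm.msub, Name.sub_sub, ih]
  | par P Q ihP ihQ => simp only [Tm.ren, Tm.msub, ihP, ihQ]
  | pabs P ih => simp only [Tm.ren, Tm.msub, ih]; rw [PSub.liftP_ren]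
  | papp P Q ihP ihQ => simp only [Tm.ren, Tm.msub, ihP, ihQ]
  | nabs P ih => simp only [Tm.ren, Tm.msub, ih]; rw [PSub.liftN_ren, NSub.lift_comp]
  | napp P n ih => simp only [Tm.ren, Tm.msub, Name.sub_sub, ih]

theorem PSub.liftP_msub {Γ Γ' Γ'' : List (Ty σ.NSort)} {Δ Δ' : List σ.NSort} {S : Ty σ.NSort}
    (θ : PSub σ Γ Γ' Δ) (θ' : PSub σ Γ' Γ'' Δ') (ν : NSub σ Δ Δ') :
    (fun _ x => (PSub.liftP (S := S) θ x).msub (PSub.liftP θ') ν) =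
      PSub.liftP (fun _ x => (θ x).msub θ' ν) := by
  funext _ x
  cases x with
  | z => rfl
  | s x =>
    simp only [PSub.liftP, Tm.wkP, Tm.msub_ren, Tm.ren_msub]
    congr; funext _ x; exact (Name.sub_id _).symm

theorem PSub.liftN_msub {Γ Γ' Γ'' : List (Ty σ.NSort)} {Δ Δ' : List σ.NSort} {k : σ.NSort}
    (θ : PSub σ Γ Γ' Δ) (θ' : PSub σ Γ' Γ'' Δ') (ν : NSub σ Δ Δ') :
    (fun _ x => (PSub.liftN (k := k) θ x).msub (PSub.liftN θ') (NSub.lift ν)) =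
      PSub.liftN (fun _ x => (θ x).msub θ' ν) := by
  funext _ x
  simp only [PSub.liftN, Tm.wkN, Tm.msub_ren, Tm.ren_msub]
  rfl

theorem Tm.msub_msub {Γ : List (Ty σ.NSort)} {Δ : List σ.NSort} {T : Ty σ.NSort} (P : Tm σ Γ Δ T)
    {Γ' Γ'' : List (Ty σ.NSort)} {Δ' Δ'' : List σ.NSort} (θ : PSub σ Γ Γ' Δ') (ν : NSub σ Δ Δ')
    (θ' : PSub σ Γ' Γ'' Δ'') (ν' : NSub σ Δ' Δ'') :
    (P.msub θ ν).msub θ' ν' = P.msub (fun _ x => (θ x).msub θ' ν') (fun _ x => (ν x).sub ν') := by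
  induction P generalizing Γ' Γ'' Δ' Δ'' with
  | nil => rfl
  | var x => rfl
  | inp m P ih => simp only [Tm.msub, Name.sub_sub, ih]; rw [PSub.liftP_msub]
  | out m Q ih => simp only [Tm.msub, Name.sub_sub, ih]
  | par P Q ihP ihQ => simp only [Tm.msub, ihP, ihQ]
  | pabs P ih => simp only [Tm.msub, ih]; rw [PSub.liftP_msub]
  | papp P Q ihP ihQ => simp only [Tm.msub, ihP, ihQ]
  | nabs P ih => simp only [Tm.msub, ih]; rw [PSub.liftN_msub, NSub.lift_comp]
  | napp P n ih => simp only [Tm.msub, Name.sub_sub, ih]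

theorem Tm.msub_id {Γ : List (Ty σ.NSort)} {Δ : List σ.NSort} {T : Ty σ.NSort} (P : Tm σ Γ Δ T) :
    P.msub (fun _ x => .var x) (fun _ x => .var x) = P := by
  rw [← Tm.ren_eq_msub P (fun _ x => x), Tm.ren_id]

variable {Γ Γ' : List (Ty σ.NSort)} {Δ Δ' : List σ.NSort} {S T : Ty σ.NSort} {k : σ.NSort}

theorem Tm.msub_wkP (P : Tm σ Γ Δ T) (θ : PSub σ Γ Γ' Δ') (ν : NSub σ Δ Δ') :
    (P.wkP (S := S)).msub (PSub.liftP θ) ν = (P.msub θ ν).wkP := by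
  simp only [Tm.wkP, Tm.msub_ren, Tm.ren_msub, PSub.liftP]
  congr; funext _ x; exact (Name.sub_id _).symm

theorem Tm.msub_psubst (P : Tm σ (S :: Γ) Δ T) (Q : Tm σ Γ Δ S) (θ : PSub σ Γ Γ' Δ')
    (ν : NSub σ Δ Δ') :
    (P.psubst Q).msub θ ν = (P.msub (PSub.liftP θ) ν).psubst (Q.msub θ ν) := by
  simp only [Tm.psubst, Tm.sub_eq_msub, Tm.msub_msub]
  congr
  · funext _ x
    cases x with
    | z => rfl
    | s x =>
      simp only [PSub.single, PSub.liftP, Tm.wkP, Tm.msub_ren, Tm.msub]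
      exact (Tm.msub_id _).symm
  · funext _ x; exact (Name.sub_id _).symm

theorem Tm.ren_psubst (P : Tm σ (S :: Γ) Δ T) (Q : Tm σ Γ Δ S) (ρ : PRen σ Γ Γ')
    (ν : NSub σ Δ Δ') :
    (P.psubst Q).ren ρ ν = (P.ren (PRen.lift ρ) ν).psubst (Q.ren ρ ν) := by
  simp only [Tm.ren_eq_msub, Tm.msub_psubst, PSub.liftP_var]

theorem Tm.nsubst_eq_msub (P : Tm σ Γ (k :: Δ) T) (m : Name σ Δ k) :
    P.nsubst m = P.msub (fun _ x => .var x) (NSub.single m) :=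
  Tm.ren_eq_msub _ _ _

theorem Tm.msub_nsubst (P : Tm σ Γ (k :: Δ) T) (m : Name σ Δ k) (θ : PSub σ Γ Γ' Δ')
    (ν : NSub σ Δ Δ') :
    (P.nsubst m).msub θ ν = (P.msub (PSub.liftN θ) (NSub.lift ν)).nsubst (m.sub ν) := by
  simp only [Tm.nsubst_eq_msub, Tm.msub_msub]
  congr
  · funext _ x
    simp only [PSub.liftN, Tm.wkN, Tm.msub_ren, Tm.msub]
    exact (Tm.msub_id _).symm
  · funext _ x
    cases x with
    | z => rfl
    | s x =>
      simp only [NSub.single, NSub.lift, Name.sub_sub]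
      exact (Name.sub_id _).symm

theorem Tm.ren_nsubst (P : Tm σ Γ (k :: Δ) T) (m : Name σ Δ k) (ρ : PRen σ Γ Γ')
    (ν : NSub σ Δ Δ') :
    (P.nsubst m).ren ρ ν = (P.ren ρ (NSub.lift ν)).nsubst (m.sub ν) := by
  simp only [Tm.ren_eq_msub, Tm.msub_nsubst]
  rfl

theorem Tm.psubst_wkP (P : Tm σ Γ Δ T) (Q : Tm σ Γ Δ S) : P.wkP.psubst Q = P := by
  simp only [Tm.wkP, Tm.psubst, Tm.sub_eq_msub, Tm.msub_ren]
  exact Tm.msub_id P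

theorem Tm.msub_copies (n : ℕ) (P : Tm σ Γ Δ .proc) (θ : PSub σ Γ Γ' Δ') (ν : NSub σ Δ Δ') :
    (Tm.copies n P).msub θ ν = Tm.copies n (P.msub θ ν) := by
  induction n with
  | zero => rfl
  | succ n ih => simp only [Tm.copies, Tm.msub, ih]

end SubstitutionAlgebra

/-! ### Complete developments -/

section Development

variable {σ : Sorting.{u}} {Γ Γ' : List (Ty σ.NSort)} {Δ Δ' : List σ.NSort} {S T : Ty σ.NSort}
  {k : σ.NSort}

/-- Application of a term to a term, contracted if the function is an abstraction. -/
def Tm.pappRed : Tm σ Γ Δ (.pabs S) → Tm σ Γ Δ S → Tm σ Γ Δ .proc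
  | .var x, Q => .papp (.var x) Q
  | .pabs P, Q => P.psubst Q

/-- Application of a term to a name, contracted if the function is an abstraction. -/
def Tm.nappRed : Tm σ Γ Δ (.nabs k) → Name σ Δ k → Tm σ Γ Δ .proc
  | .var x, n => .napp (.var x) n
  | .nabs P, n => P.nsubst n

/-- The complete development: all application redexes of the term are contracted. -/
def Tm.dev {Γ : List (Ty σ.NSort)} {Δ : List σ.NSort} {T : Ty σ.NSort} :
    Tm σ Γ Δ T → Tm σ Γ Δ T
  | .nil => .nil
  | .var x => .var x
  | .inp m P => .inp m P.dev
  | .out m Q => .out m Q.dev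
  | .par P Q => .par P.dev Q.dev
  | .pabs P => .pabs P.dev
  | .papp P Q => P.dev.pappRed Q.dev
  | .nabs P => .nabs P.dev
  | .napp P n => P.dev.nappRed n

theorem Tm.ren_pappRed (P : Tm σ Γ Δ (.pabs S)) (Q : Tm σ Γ Δ S) (ρ : PRen σ Γ Γ')
    (ν : NSub σ Δ Δ') : (P.pappRed Q).ren ρ ν = (P.ren ρ ν).pappRed (Q.ren ρ ν) := by
  cases P with
  | var x => rfl
  | pabs P => exact Tm.ren_psubst P Q ρ ν

theorem Tm.ren_nappRed (P : Tm σ Γ Δ (.nabs k)) (n : Name σ Δ k) (ρ : PRen σ Γ Γ')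
    (ν : NSub σ Δ Δ') : (P.nappRed n).ren ρ ν = (P.ren ρ ν).nappRed (n.sub ν) := by
  cases P with
  | var x => rfl
  | nabs P => exact Tm.ren_nsubst P n ρ ν

theorem Tm.dev_ren (P : Tm σ Γ Δ T) (ρ : PRen σ Γ Γ') (ν : NSub σ Δ Δ') :
    (P.ren ρ ν).dev = P.dev.ren ρ ν := by
  induction P generalizing Γ' Δ' with
  | nil => rfl
  | var x => rfl
  | inp m P ih => simp only [Tm.ren, Tm.dev, ih]
  | out m Q ih => simp only [Tm.ren, Tm.dev, ih]
  | par P Q ihP ihQ => simp only [Tm.ren, Tm.dev, ihP, ihQ]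
  | pabs P ih => simp only [Tm.ren, Tm.dev, ih]
  | papp P Q ihP ihQ => simp only [Tm.ren, Tm.dev, ihP, ihQ, Tm.ren_pappRed]
  | nabs P ih => simp only [Tm.ren, Tm.dev, ih]
  | napp P n ih => simp only [Tm.ren, Tm.dev, ih, Tm.ren_nappRed]

theorem Tm.dev_wkP (P : Tm σ Γ Δ T) : (P.wkP (S := S)).dev = P.dev.wkP :=
  Tm.dev_ren P _ _

theorem Tm.dev_copies (n : ℕ) (P : Tm σ Γ Δ .proc) :
    (Tm.copies n P).dev = Tm.copies n P.dev := by
  induction n with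
  | zero => rfl
  | succ n ih => simp only [Tm.copies, Tm.dev, ih]

end Development

/-! ### Congruences preserved by substitution and development -/

section Congruence

variable {σ : Sorting.{u}}

/-- `P` and `Q` are the same variable or abstractions of the same kind with related bodies, unless
they are processes. -/
inductive HeadMatch (R : TRel σ) : TRel σ
  | proc {Γ Δ} (P Q : Tm σ Γ Δ .proc) : HeadMatch R P Q
  | var {Γ Δ T} (x : Var Γ T) : HeadMatch R (Tm.var (Δ := Δ) x) (.var x)
  | pabs {Γ Δ S} {P Q : Tm σ (S :: Γ) Δ .proc} : R P Q → HeadMatch R (.pabs P) (.pabs Q)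
  | nabs {Γ Δ k} {P Q : Tm σ Γ (k :: Δ) .proc} : R P Q → HeadMatch R (.nabs P) (.nabs Q)

/-- At an abstraction type no law applies at the root, and the only terms are variables and
abstractions, so a congruence can only act inside a body. -/
theorem Cong.headMatch {B : TRel σ} (hB : ∀ {Γ Δ T} {P Q : Tm σ Γ Δ T}, B P Q → T = .proc)
    {Γ Δ T} {P Q : Tm σ Γ Δ T} (h : Cong B P Q) : HeadMatch (Cong B) P Q := by
  induction h with
  | base h => cases hB h; exact .proc _ _
  | refl P =>
    cases P
    case var => exact .var _
    case pabs => exact .pabs (.refl _)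
    case nabs => exact .nabs (.refl _)
    all_goals exact .proc _ _
  | symm _ ih =>
    cases ih with
    | proc => exact .proc _ _
    | var => exact .var _
    | pabs h => exact .pabs h.symm
    | nabs h => exact .nabs h.symm
  | trans _ _ ih₁ ih₂ =>
    cases ih₁ with
    | proc => exact .proc _ _
    | var => exact ih₂
    | pabs h => cases ih₂ with | pabs h' => exact .pabs (h.trans h')
    | nabs h => cases ih₂ with | nabs h' => exact .nabs (h.trans h')
  | pabs h => exact .pabs h
  | nabs h => exact .nabs h
  | inp | out | par | papp | napp => exact .proc _ _

/-- Laws between processes that are closed under substitution and complete development. -/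
structure Stable (B : TRel σ) : Prop where
  proc : ∀ {Γ Δ T} {P Q : Tm σ Γ Δ T}, B P Q → T = .proc
  msub : ∀ {Γ Δ T} {P Q : Tm σ Γ Δ T}, B P Q → ∀ {Γ' Δ'} (θ : PSub σ Γ Γ' Δ') (ν : NSub σ Δ Δ'),
    B (P.msub θ ν) (Q.msub θ ν)
  dev : ∀ {Γ Δ T} {P Q : Tm σ Γ Δ T}, B P Q → B P.dev Q.dev

theorem Cong.mono {B B' : TRel σ} (h : ∀ {Γ Δ T} {P Q : Tm σ Γ Δ T}, B P Q → B' P Q)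
    {Γ Δ T} {P Q : Tm σ Γ Δ T} (hPQ : Cong B P Q) : Cong B' P Q := by
  induction hPQ with
  | base hb => exact .base (h hb)
  | refl P => exact .refl P
  | symm _ ih => exact ih.symm
  | trans _ _ ih₁ ih₂ => exact ih₁.trans ih₂
  | inp m _ ih => exact ih.inp m
  | out m _ ih => exact ih.out m
  | par _ _ ih₁ ih₂ => exact ih₁.par ih₂
  | pabs _ ih => exact ih.pabs
  | papp _ _ ih₁ ih₂ => exact ih₁.papp ih₂
  | nabs _ ih => exact ih.nabs
  | napp n _ ih => exact ih.napp n

/-- Closure under substitution is the only assumption, not `Stable`, so that this also applies to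
structural congruence in `SCongr.wkP`. -/
theorem Cong.msub {B : TRel σ}
    (hB : ∀ {Γ Δ T} {P Q : Tm σ Γ Δ T}, B P Q →
      ∀ {Γ' Δ'} (θ : PSub σ Γ Γ' Δ') (ν : NSub σ Δ Δ'), B (P.msub θ ν) (Q.msub θ ν))
    {Γ Δ T} {P Q : Tm σ Γ Δ T} (h : Cong B P Q) {Γ' Δ'} (θ : PSub σ Γ Γ' Δ') (ν : NSub σ Δ Δ') :
    Cong B (P.msub θ ν) (Q.msub θ ν) := by
  induction h generalizing Γ' Δ' with
  | base hb => exact .base (hB hb θ ν)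
  | refl P => exact .refl _
  | symm _ ih => exact (ih θ ν).symm
  | trans _ _ ih₁ ih₂ => exact (ih₁ θ ν).trans (ih₂ θ ν)
  | inp m _ ih => exact (ih _ _).inp _
  | out m _ ih => exact (ih _ _).out _
  | par _ _ ih₁ ih₂ => exact (ih₁ _ _).par (ih₂ _ _)
  | pabs _ ih => exact (ih _ _).pabs
  | papp _ _ ih₁ ih₂ => exact (ih₁ _ _).papp (ih₂ _ _)
  | nabs _ ih => exact (ih _ _).nabs
  | napp n _ ih => exact (ih _ _).napp _

section

variable {B : TRel σ} (hB : Stable B)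
include hB

theorem Cong.ren {Γ Δ T} {P Q : Tm σ Γ Δ T} (h : Cong B P Q) {Γ' Δ'} (ρ : PRen σ Γ Γ')
    (ν : NSub σ Δ Δ') : Cong B (P.ren ρ ν) (Q.ren ρ ν) := by
  rw [Tm.ren_eq_msub, Tm.ren_eq_msub]
  exact h.msub hB.msub _ _

theorem Cong.wkP {Γ Δ T S} {P Q : Tm σ Γ Δ T} (h : Cong B P Q) :
    Cong B (P.wkP (S := S)) Q.wkP :=
  h.ren hB _ _

theorem Cong.msub_congr {Γ Δ T} (P : Tm σ Γ Δ T) {Γ' Δ'} {θ θ' : PSub σ Γ Γ' Δ'} (ν : NSub σ Δ Δ')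
    (h : ∀ ⦃T⦄ (x : Var Γ T), Cong B (θ x) (θ' x)) : Cong B (P.msub θ ν) (P.msub θ' ν) := by
  have hP : ∀ {Γ Γ' : List (Ty σ.NSort)} {Δ : List σ.NSort} {S} {θ θ' : PSub σ Γ Γ' Δ},
      (∀ ⦃T⦄ (x : Var Γ T), Cong B (θ x) (θ' x)) →
        ∀ ⦃T⦄ (x : Var (S :: Γ) T), Cong B (PSub.liftP θ x) (PSub.liftP θ' x) := by
    intro Γ Γ' Δ S θ θ' h T x
    cases x with
    | z => exact .refl _
    | s x => exact (h x).wkP hB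
  induction P generalizing Γ' Δ' with
  | nil => exact .refl _
  | var x => exact h x
  | inp m P ih => exact (ih ν (hP h)).inp _
  | out m Q ih => exact (ih ν h).out _
  | par P Q ihP ihQ => exact (ihP ν h).par (ihQ ν h)
  | pabs P ih => exact (ih ν (hP h)).pabs
  | papp P Q ihP ihQ => exact (ihP ν h).papp (ihQ ν h)
  | nabs P ih => exact (ih _ fun _ x => (h x).ren hB _ _).nabs
  | napp P n ih => exact (ih ν h).napp _

theorem Cong.psubst {Γ Δ S T} {P P' : Tm σ (S :: Γ) Δ T} {Q Q' : Tm σ Γ Δ S} (hP : Cong B P P')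
    (hQ : Cong B Q Q') : Cong B (P.psubst Q) (P'.psubst Q') := by
  simp only [Tm.psubst, Tm.sub_eq_msub]
  refine (hP.msub hB.msub _ _).trans (Cong.msub_congr hB _ _ ?_)
  intro T x
  cases x with
  | z => exact hQ
  | s x => exact .refl _

theorem Cong.nsubst {Γ Δ k T} {P P' : Tm σ Γ (k :: Δ) T} (hP : Cong B P P') (m : Name σ Δ k) :
    Cong B (P.nsubst m) (P'.nsubst m) :=
  hP.ren hB _ _

/-- Congruent functions are the same variable or are both abstractions, by `Cong.headMatch`. So
corresponding applications are either both contracted or both kept. -/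
theorem Cong.dev {Γ Δ T} {P Q : Tm σ Γ Δ T} (h : Cong B P Q) : Cong B P.dev Q.dev := by
  induction h with
  | base hb => exact .base (hB.dev hb)
  | refl P => exact .refl _
  | symm _ ih => exact ih.symm
  | trans _ _ ih₁ ih₂ => exact ih₁.trans ih₂
  | inp m _ ih => exact ih.inp m
  | out m _ ih => exact ih.out m
  | par _ _ ih₁ ih₂ => exact ih₁.par ih₂
  | pabs _ ih => exact ih.pabs
  | papp _ _ ih₁ ih₂ =>
    simp only [Tm.dev]
    revert ih₁
    generalize Tm.dev _ = F
    generalize Tm.dev _ = F'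
    intro h
    cases h.headMatch hB.proc with
    | var x => exact (Cong.refl _).papp ih₂
    | pabs h' => exact h'.psubst hB ih₂
  | nabs _ ih => exact ih.nabs
  | napp n _ ih =>
    simp only [Tm.dev]
    revert ih
    generalize Tm.dev _ = F
    generalize Tm.dev _ = F'
    intro h
    cases h.headMatch hB.proc with
    | var x => exact .refl _
    | nabs h' => exact h'.nsubst hB n

end

/-- The laws of `MCongr`, extended by `DIS`. -/
def MonoidDisLaw : TRel σ := fun _ _ _ P Q => MonoidLaw P Q ∨ DisLaw P Q

theorem stable_monoidLaw : Stable (MonoidLaw (σ := σ)) where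
  proc h := by cases h <;> rfl
  msub h _ _ θ ν := by
    cases h with
    | assoc => exact .assoc _ _ _
    | comm => exact .comm _ _
    | unit => exact .unit _
  dev h := by
    cases h with
    | assoc => exact .assoc _ _ _
    | comm => exact .comm _ _
    | unit => exact .unit _

theorem DisLaw.msub {Γ Δ T} {P Q : Tm σ Γ Δ T} (h : DisLaw P Q) {Γ' Δ'} (θ : PSub σ Γ Γ' Δ')
    (ν : NSub σ Δ Δ') : DisLaw (P.msub θ ν) (Q.msub θ ν) := by
  cases h with
  | dis m P k hk =>
    simp only [Tm.msub, Tm.msub_copies, Tm.msub_wkP]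
    exact .dis (m.sub ν) (P.msub (PSub.liftP θ) ν) k hk

/-- Substitution and development commute with weakening and with `Tm.copies`, hence send an instance
of DIS to another with the same number of copies. -/
theorem stable_monoidDisLaw : Stable (MonoidDisLaw (σ := σ)) where
  proc h := h.elim (fun h => by cases h <;> rfl) (fun h => by cases h; rfl)
  msub h _ _ θ ν := h.imp (fun h => stable_monoidLaw.msub h θ ν) (fun h => h.msub θ ν)
  dev h := by
    refine h.imp (fun h => stable_monoidLaw.dev h) fun h => ?_
    cases h with
    | dis m P k hk =>
      simp only [Tm.dev, Tm.dev_copies, Tm.dev_wkP]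
      exact .dis m P.dev k hk

end Congruence

/-! ### Parallel reduction and the triangle property -/

section ParallelReduction

variable {σ : Sorting.{u}}

/-- Parallel reduction: some of the application redexes of a term are contracted. -/
inductive ParRed : TRel σ
  | nil {Γ Δ} : ParRed (Tm.nil (Γ := Γ) (Δ := Δ)) .nil
  | var {Γ Δ T} (x : Var Γ T) : ParRed (Tm.var (Δ := Δ) x) (.var x)
  | inp {Γ Δ} {k : σ.NSort} (m : Name σ Δ k) {P Q : Tm σ (σ.obj k :: Γ) Δ .proc} :
      ParRed P Q → ParRed (.inp m P) (.inp m Q)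
  | out {Γ Δ} {k : σ.NSort} (m : Name σ Δ k) {P Q : Tm σ Γ Δ (σ.obj k)} :
      ParRed P Q → ParRed (.out m P) (.out m Q)
  | par {Γ Δ} {P P' Q Q' : Tm σ Γ Δ .proc} :
      ParRed P P' → ParRed Q Q' → ParRed (.par P Q) (.par P' Q')
  | pabs {Γ Δ S} {P Q : Tm σ (S :: Γ) Δ .proc} : ParRed P Q → ParRed (.pabs P) (.pabs Q)
  | papp {Γ Δ S} {P P' : Tm σ Γ Δ (.pabs S)} {Q Q' : Tm σ Γ Δ S} :
      ParRed P P' → ParRed Q Q' → ParRed (.papp P Q) (.papp P' Q')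
  | nabs {Γ Δ k} {P Q : Tm σ Γ (k :: Δ) .proc} : ParRed P Q → ParRed (.nabs P) (.nabs Q)
  | napp {Γ Δ k} {P P' : Tm σ Γ Δ (.nabs k)} (n : Name σ Δ k) :
      ParRed P P' → ParRed (.napp P n) (.napp P' n)
  | app1 {Γ Δ S} {P P' : Tm σ (S :: Γ) Δ .proc} {Q Q' : Tm σ Γ Δ S} :
      ParRed P P' → ParRed Q Q' → ParRed (.papp (.pabs P) Q) (P'.psubst Q')
  | app2 {Γ Δ k} {P P' : Tm σ Γ (k :: Δ) .proc} (m : Name σ Δ k) :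
      ParRed P P' → ParRed (.napp (.nabs P) m) (P'.nsubst m)

theorem ParRed.refl {Γ Δ T} (P : Tm σ Γ Δ T) : ParRed P P := by
  induction P with
  | nil => exact .nil
  | var x => exact .var x
  | inp m P ih => exact .inp m ih
  | out m Q ih => exact .out m ih
  | par P Q ihP ihQ => exact .par ihP ihQ
  | pabs P ih => exact .pabs ih
  | papp P Q ihP ihQ => exact .papp ihP ihQ
  | nabs P ih => exact .nabs ih
  | napp P n ih => exact .napp n ih

theorem ParRed.ren {Γ Δ T} {P Q : Tm σ Γ Δ T} (h : ParRed P Q) {Γ' Δ'} (ρ : PRen σ Γ Γ')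
    (ν : NSub σ Δ Δ') : ParRed (P.ren ρ ν) (Q.ren ρ ν) := by
  induction h generalizing Γ' Δ' with
  | nil => exact .nil
  | var x => exact .var _
  | inp m _ ih => exact .inp _ (ih _ _)
  | out m _ ih => exact .out _ (ih _ _)
  | par _ _ ih₁ ih₂ => exact .par (ih₁ _ _) (ih₂ _ _)
  | pabs _ ih => exact .pabs (ih _ _)
  | papp _ _ ih₁ ih₂ => exact .papp (ih₁ _ _) (ih₂ _ _)
  | nabs _ ih => exact .nabs (ih _ _)
  | napp n _ ih => exact .napp _ (ih _ _)
  | app1 _ _ ih₁ ih₂ => rw [Tm.ren_psubst]; exact .app1 (ih₁ _ _) (ih₂ _ _)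
  | app2 m _ ih => rw [Tm.ren_nsubst]; exact .app2 _ (ih _ _)

theorem ParRed.liftP {Γ Γ' : List (Ty σ.NSort)} {Δ : List σ.NSort} {S} {θ θ' : PSub σ Γ Γ' Δ}
    (h : ∀ ⦃T⦄ (x : Var Γ T), ParRed (θ x) (θ' x)) ⦃T⦄ (x : Var (S :: Γ) T) :
    ParRed (PSub.liftP θ x) (PSub.liftP θ' x) := by
  cases x with
  | z => exact .var _
  | s x => exact (h x).ren _ _

theorem ParRed.msub {Γ Δ T} {P Q : Tm σ Γ Δ T} (hPQ : ParRed P Q) {Γ' Δ'}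
    {θ θ' : PSub σ Γ Γ' Δ'} (ν : NSub σ Δ Δ') (h : ∀ ⦃T⦄ (x : Var Γ T), ParRed (θ x) (θ' x)) :
    ParRed (P.msub θ ν) (Q.msub θ' ν) := by
  induction hPQ generalizing Γ' Δ' with
  | nil => exact .nil
  | var x => exact h x
  | inp m _ ih => exact .inp _ (ih _ (ParRed.liftP h))
  | out m _ ih => exact .out _ (ih _ h)
  | par _ _ ih₁ ih₂ => exact .par (ih₁ _ h) (ih₂ _ h)
  | pabs _ ih => exact .pabs (ih _ (ParRed.liftP h))
  | papp _ _ ih₁ ih₂ => exact .papp (ih₁ _ h) (ih₂ _ h)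
  | nabs _ ih => exact .nabs (ih _ fun _ x => (h x).ren _ _)
  | napp n _ ih => exact .napp _ (ih _ h)
  | app1 _ _ ih₁ ih₂ => rw [Tm.msub_psubst]; exact .app1 (ih₁ _ (ParRed.liftP h)) (ih₂ _ h)
  | app2 m _ ih => rw [Tm.msub_nsubst]; exact .app2 _ (ih _ fun _ x => (h x).ren _ _)

theorem ParRed.psubst {Γ Δ S T} {P P' : Tm σ (S :: Γ) Δ T} {Q Q' : Tm σ Γ Δ S} (hP : ParRed P P')
    (hQ : ParRed Q Q') : ParRed (P.psubst Q) (P'.psubst Q') := by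
  simp only [Tm.psubst, Tm.sub_eq_msub]
  refine hP.msub _ ?_
  intro T x
  cases x with
  | z => exact hQ
  | s x => exact .var _

/-- Every parallel reduct reduces to the complete development. -/
theorem ParRed.triangle {Γ Δ T} {P Q : Tm σ Γ Δ T} (h : ParRed P Q) : ParRed Q P.dev := by
  induction h with
  | nil => exact .nil
  | var x => exact .var x
  | inp m _ ih => exact .inp m ih
  | out m _ ih => exact .out m ih
  | par _ _ ih₁ ih₂ => exact .par ih₁ ih₂
  | pabs _ ih => exact .pabs ih
  | @papp _ _ _ P P' Q Q' h₁ _ ih₁ ih₂ =>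
    cases h₁ with
    | var x => exact .papp (.var x) ih₂
    | pabs h => cases ih₁ with | pabs ih₁ => exact .app1 ih₁ ih₂
  | nabs _ ih => exact .nabs ih
  | @napp _ _ _ P P' n h₁ ih =>
    cases h₁ with
    | var x => exact .napp n (.var x)
    | nabs h => cases ih with | nabs ih => exact .app2 n ih
  | app1 _ _ ih₁ ih₂ => exact ih₁.psubst ih₂
  | app2 m _ ih => exact ih.ren _ _

theorem ParRed.dev_iterate {Γ Δ T} {P Q : Tm σ Γ Δ T} (h : ParRed P Q) (n : ℕ) :
    ParRed (Tm.dev^[n] P) (Tm.dev^[n] Q) := by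
  induction n generalizing P Q with
  | zero => exact h
  -- Two triangles make development monotone: from P to Q follows Q to `P.dev`, hence `P.dev` to
  -- `Q.dev`.
  | succ n ih => exact ih h.triangle.triangle

end ParallelReduction

/-! ### Normalization of application redexes -/

section BetaNormal

variable {σ : Sorting.{u}}

/-- The term has no subterm that is an application of an abstraction. -/
def Tm.BetaNormal {Γ : List (Ty σ.NSort)} {Δ : List σ.NSort} {T : Ty σ.NSort} :
    Tm σ Γ Δ T → Prop
  | .nil => True
  | .var _ => True
  | .inp _ P => P.BetaNormal
  | .out _ Q => Q.BetaNormal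
  | .par P Q => P.BetaNormal ∧ Q.BetaNormal
  | .pabs P => P.BetaNormal
  | .papp P Q => ¬ P.IsAbs ∧ Q.BetaNormal
  | .nabs P => P.BetaNormal
  | .napp P _ => ¬ P.IsAbs

/-- Applications are always processes, so a function position holds only a variable or an
abstraction. -/
theorem Tm.eq_var_of_not_isAbs_pabs {Γ Δ S} {P : Tm σ Γ Δ (.pabs S)} (h : ¬ P.IsAbs) :
    ∃ x, P = .var x := by
  cases P with
  | var x => exact ⟨x, rfl⟩
  | pabs P => exact (h trivial).elim

theorem Tm.eq_var_of_not_isAbs_nabs {Γ Δ k} {P : Tm σ Γ Δ (.nabs k)} (h : ¬ P.IsAbs) :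
    ∃ x, P = .var x := by
  cases P with
  | var x => exact ⟨x, rfl⟩
  | nabs P => exact (h trivial).elim

theorem Tm.isAbs_ren {Γ Δ T} {P : Tm σ Γ Δ T} {Γ' Δ'} (ρ : PRen σ Γ Γ') (ν : NSub σ Δ Δ') :
    (P.ren ρ ν).IsAbs ↔ P.IsAbs := by
  cases P <;> exact Iff.rfl

theorem Tm.BetaNormal.ren {Γ Δ T} {P : Tm σ Γ Δ T} (h : P.BetaNormal) {Γ' Δ'} (ρ : PRen σ Γ Γ')
    (ν : NSub σ Δ Δ') : (P.ren ρ ν).BetaNormal := by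
  induction P generalizing Γ' Δ' with
  | nil => trivial
  | var x => trivial
  | inp m P ih => exact ih h _ _
  | out m Q ih => exact ih h _ _
  | par P Q ihP ihQ => exact ⟨ihP h.1 _ _, ihQ h.2 _ _⟩
  | pabs P ih => exact ih h _ _
  | papp P Q ihP ihQ => exact ⟨fun hP => h.1 ((Tm.isAbs_ren _ _).1 hP), ihQ h.2 _ _⟩
  | nabs P ih => exact ih h _ _
  | napp P n ih => exact fun hP => h ((Tm.isAbs_ren _ _).1 hP)

theorem Tm.BetaNormal.eq_of_parRed {Γ Δ T} {P Q : Tm σ Γ Δ T} (hP : P.BetaNormal)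
    (h : ParRed P Q) : Q = P := by
  induction h with
  | nil => rfl
  | var x => rfl
  | inp m _ ih => rw [ih hP]
  | out m _ ih => rw [ih hP]
  | par _ _ ih₁ ih₂ => rw [ih₁ hP.1, ih₂ hP.2]
  | pabs _ ih => rw [ih hP]
  | papp h₁ _ ih₁ ih₂ =>
    obtain ⟨x, rfl⟩ := Tm.eq_var_of_not_isAbs_pabs hP.1
    rw [ih₁ trivial, ih₂ hP.2]
  | nabs _ ih => rw [ih hP]
  | napp n _ ih =>
    obtain ⟨x, rfl⟩ := Tm.eq_var_of_not_isAbs_nabs hP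
    rw [ih trivial]
  | app1 => exact (hP.1 trivial).elim
  | app2 => exact (hP trivial).elim

theorem Tm.BetaNormal.dev_iterate {Γ Δ T} {P : Tm σ Γ Δ T} (hP : P.BetaNormal) (n : ℕ) :
    Tm.dev^[n] P = P :=
  Function.iterate_fixed (hP.eq_of_parRed (ParRed.refl P).triangle) n

/-- Reduction of application redexes. -/
abbrev AppSteps {Γ Δ T} : Tm σ Γ Δ T → Tm σ Γ Δ T → Prop :=
  Relation.ReflTransGen (fun A B => InSubterm AppLaw A B)

theorem InSubterm.parRed {Γ Δ T} {P Q : Tm σ Γ Δ T} (h : InSubterm AppLaw P Q) : ParRed P Q := by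
  induction h with
  | here h =>
    cases h with
    | app1 => exact .app1 (.refl _) (.refl _)
    | app2 => exact .app2 _ (.refl _)
  | inp m _ ih => exact .inp m ih
  | out m _ ih => exact .out m ih
  | parL Q _ ih => exact .par ih (.refl _)
  | parR P _ ih => exact .par (.refl _) ih
  | pabs _ ih => exact .pabs ih
  | pappL Q _ ih => exact .papp ih (.refl _)
  | pappR P _ ih => exact .papp (.refl _) ih
  | nabs _ ih => exact .nabs ih
  | napp n _ ih => exact .napp n ih

namespace AppSteps

theorem inp {Γ Δ} {k : σ.NSort} (m : Name σ Δ k) {P Q : Tm σ (σ.obj k :: Γ) Δ .proc}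
    (h : AppSteps P Q) : AppSteps (.inp m P) (.inp m Q) :=
  h.lift (Tm.inp m) fun _ _ => .inp m

theorem out {Γ Δ} {k : σ.NSort} (m : Name σ Δ k) {P Q : Tm σ Γ Δ (σ.obj k)}
    (h : AppSteps P Q) : AppSteps (.out m P) (.out m Q) :=
  h.lift (Tm.out m) fun _ _ => .out m

theorem par {Γ Δ} {P P' Q Q' : Tm σ Γ Δ .proc} (h₁ : AppSteps P P') (h₂ : AppSteps Q Q') :
    AppSteps (.par P Q) (.par P' Q') :=
  (h₁.lift (Tm.par · Q) fun _ _ => .parL Q).trans (h₂.lift (Tm.par P' ·) fun _ _ => .parR P')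

theorem pabs {Γ Δ S} {P Q : Tm σ (S :: Γ) Δ .proc} (h : AppSteps P Q) :
    AppSteps (.pabs P) (.pabs Q) :=
  h.lift Tm.pabs fun _ _ => .pabs

theorem papp {Γ Δ S} {P P' : Tm σ Γ Δ (.pabs S)} {Q Q' : Tm σ Γ Δ S} (h₁ : AppSteps P P')
    (h₂ : AppSteps Q Q') : AppSteps (.papp P Q) (.papp P' Q') :=
  (h₁.lift (Tm.papp · Q) fun _ _ => .pappL Q).trans (h₂.lift (Tm.papp P' ·) fun _ _ => .pappR P')

theorem nabs {Γ Δ k} {P Q : Tm σ Γ (k :: Δ) .proc} (h : AppSteps P Q) :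
    AppSteps (.nabs P) (.nabs Q) :=
  h.lift Tm.nabs fun _ _ => .nabs

theorem napp {Γ Δ k} {P P' : Tm σ Γ Δ (.nabs k)} (n : Name σ Δ k) (h : AppSteps P P') :
    AppSteps (.napp P n) (.napp P' n) :=
  h.lift (Tm.napp · n) fun _ _ => .napp n

end AppSteps

/-- The nesting depth of process abstractions in a type. -/
def Ty.depth {K : Type u} : Ty K → ℕ
  | .proc => 0
  | .pabs S => S.depth + 1
  | .nabs _ => 0

/-- `θ` substitutes variables, or normal terms of a type of depth at most `n`. -/
def PSub.DepthLE {Γ Γ' : List (Ty σ.NSort)} {Δ : List σ.NSort} (n : ℕ) (θ : PSub σ Γ Γ' Δ) : Prop :=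
  ∀ ⦃T⦄ (x : Var Γ T), (∃ y, θ x = .var y) ∨ (θ x).BetaNormal ∧ T.depth ≤ n

theorem PSub.DepthLE.liftP {Γ Γ' : List (Ty σ.NSort)} {Δ : List σ.NSort} {n : ℕ}
    {θ : PSub σ Γ Γ' Δ} (h : θ.DepthLE n) {S} : (PSub.liftP (S := S) θ).DepthLE n := by
  intro T x
  cases x with
  | z => exact .inl ⟨_, rfl⟩
  | s x =>
    rcases h x with ⟨y, hy⟩ | ⟨h₁, h₂⟩
    · exact .inl ⟨.s y, by simp only [PSub.liftP, hy]; rfl⟩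
    · exact .inr ⟨h₁.ren _ _, h₂⟩

theorem PSub.DepthLE.liftN {Γ Γ' : List (Ty σ.NSort)} {Δ : List σ.NSort} {n : ℕ}
    {θ : PSub σ Γ Γ' Δ} (h : θ.DepthLE n) {k} : (PSub.liftN (k := k) θ).DepthLE n := by
  intro T x
  rcases h x with ⟨y, hy⟩ | ⟨h₁, h₂⟩
  · exact .inl ⟨y, by simp only [PSub.liftN, hy]; rfl⟩
  · exact .inr ⟨h₁.ren _ _, h₂⟩

theorem PSub.DepthLE.single {Γ : List (Ty σ.NSort)} {Δ : List σ.NSort} {S} {Q : Tm σ Γ Δ S}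
    (hQ : Q.BetaNormal) : (PSub.single Q).DepthLE S.depth := by
  intro T x
  cases x with
  | z => exact .inr ⟨hQ, le_rfl⟩
  | s x => exact .inl ⟨x, rfl⟩

/-- Hereditary substitution: an outer induction on the depth of the substituted types and an inner
one on the term. A redex arises only where an abstraction replaces a variable in function position,
and contracting it substitutes an argument whose type has smaller depth. The types carried by
channels do not enter, as no communication is performed. -/
theorem Tm.BetaNormal.exists_sub (n : ℕ) {Γ Δ T} {P : Tm σ Γ Δ T} (hP : P.BetaNormal) {Γ'}
    {θ : PSub σ Γ Γ' Δ} (hθ : θ.DepthLE n) : ∃ N, N.BetaNormal ∧ AppSteps (P.sub θ) N := by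
  induction n using Nat.strong_induction_on generalizing Γ Δ T Γ' with
  | _ n ihn =>
  induction P generalizing Γ' with
  | nil => exact ⟨.nil, trivial, .refl⟩
  | var x =>
    refine ⟨_, ?_, .refl⟩
    rcases hθ x with ⟨y, hy⟩ | h
    · simp only [Tm.sub, hy]; trivial
    · exact h.1
  | inp m P ih =>
    obtain ⟨N, hN, h⟩ := ih hP hθ.liftP
    exact ⟨.inp m N, hN, AppSteps.inp m h⟩
  | out m Q ih =>
    obtain ⟨N, hN, h⟩ := ih hP hθ
    exact ⟨.out m N, hN, AppSteps.out m h⟩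
  | par P Q ihP ihQ =>
    obtain ⟨N, hN, h⟩ := ihP hP.1 hθ
    obtain ⟨M, hM, h'⟩ := ihQ hP.2 hθ
    exact ⟨.par N M, ⟨hN, hM⟩, AppSteps.par h h'⟩
  | pabs P ih =>
    obtain ⟨N, hN, h⟩ := ih hP hθ.liftP
    exact ⟨.pabs N, hN, AppSteps.pabs h⟩
  | papp P Q _ ihQ =>
    obtain ⟨x, rfl⟩ := Tm.eq_var_of_not_isAbs_pabs hP.1
    obtain ⟨M, hM, h⟩ := ihQ hP.2 hθ
    have hstep : AppSteps (Tm.sub (.papp (.var x) Q) θ) (.papp (θ x) M) := AppSteps.papp .refl h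
    rcases hθ x with ⟨y, hy⟩ | ⟨h₁, h₂⟩
    · rw [hy] at hstep
      exact ⟨.papp (.var y) M, ⟨id, hM⟩, hstep⟩
    · revert h₁ hstep
      generalize θ x = F
      intro hstep h₁
      cases F with
      | var y => exact ⟨.papp (.var y) M, ⟨id, hM⟩, hstep⟩
      | pabs A =>
        -- The type `S` of the argument is one level shallower than `.pabs S`, whose depth is at
        -- most `n`.
        obtain ⟨N, hN, h'⟩ := ihn _ (Nat.lt_of_succ_le h₂) (P := A) h₁ (PSub.DepthLE.single hM)
        exact ⟨N, hN, (hstep.tail (.here (.app1 A M))).trans h'⟩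
  | nabs P ih =>
    obtain ⟨N, hN, h⟩ := ih hP hθ.liftN
    exact ⟨.nabs N, hN, AppSteps.nabs h⟩
  | napp P m _ =>
    obtain ⟨x, rfl⟩ := Tm.eq_var_of_not_isAbs_nabs hP
    simp only [Tm.sub]
    rcases hθ x with ⟨y, hy⟩ | ⟨h₁, _⟩
    · rw [hy]
      exact ⟨_, id, .refl⟩
    · revert h₁
      generalize θ x = F
      intro h₁
      cases F with
      | var y => exact ⟨_, id, .refl⟩
      -- Substituting a name creates no redex, so no recursive call is needed.
      | nabs A => exact ⟨_, Tm.BetaNormal.ren (P := A) h₁ _ _, .single (.here (.app2 A m))⟩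

/-- Weak normalization of application redexes. -/
theorem Tm.exists_betaNormal {Γ Δ T} (P : Tm σ Γ Δ T) : ∃ N, N.BetaNormal ∧ AppSteps P N := by
  induction P with
  | nil => exact ⟨.nil, trivial, .refl⟩
  | var x => exact ⟨.var x, trivial, .refl⟩
  | inp m P ih =>
    obtain ⟨N, hN, h⟩ := ih
    exact ⟨.inp m N, hN, AppSteps.inp m h⟩
  | out m Q ih =>
    obtain ⟨N, hN, h⟩ := ih
    exact ⟨.out m N, hN, AppSteps.out m h⟩
  | par P Q ihP ihQ =>
    obtain ⟨N, hN, h⟩ := ihP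
    obtain ⟨M, hM, h'⟩ := ihQ
    exact ⟨.par N M, ⟨hN, hM⟩, AppSteps.par h h'⟩
  | pabs P ih =>
    obtain ⟨N, hN, h⟩ := ih
    exact ⟨.pabs N, hN, AppSteps.pabs h⟩
  | papp P Q ihP ihQ =>
    obtain ⟨N, hN, h⟩ := ihP
    obtain ⟨M, hM, h'⟩ := ihQ
    cases N with
    | var y => exact ⟨.papp (.var y) M, ⟨id, hM⟩, AppSteps.papp h h'⟩
    | pabs A =>
      obtain ⟨K, hK, h''⟩ := Tm.BetaNormal.exists_sub _ (P := A) hN (PSub.DepthLE.single hM)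
      exact ⟨K, hK, ((AppSteps.papp h h').tail (.here (.app1 A M))).trans h''⟩
  | nabs P ih =>
    obtain ⟨N, hN, h⟩ := ih
    exact ⟨.nabs N, hN, AppSteps.nabs h⟩
  | napp P m ih =>
    obtain ⟨N, hN, h⟩ := ih
    cases N with
    | var y => exact ⟨.napp (.var y) m, id, AppSteps.napp m h⟩
    | nabs A =>
      exact ⟨_, Tm.BetaNormal.ren (P := A) hN _ _,
        (AppSteps.napp m h).tail (.here (.app2 A m))⟩

/-- The normal form of a term with respect to the application laws. -/
noncomputable def Tm.bnf {Γ Δ T} (P : Tm σ Γ Δ T) : Tm σ Γ Δ T :=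
  P.exists_betaNormal.choose

theorem Tm.betaNormal_bnf {Γ Δ T} (P : Tm σ Γ Δ T) : P.bnf.BetaNormal :=
  P.exists_betaNormal.choose_spec.1

theorem Tm.appSteps_bnf {Γ Δ T} (P : Tm σ Γ Δ T) : AppSteps P P.bnf :=
  P.exists_betaNormal.choose_spec.2

/-- If P reduces to Q in one step, then each iterate of development on Q reduces in parallel to the
same iterate on P. Once the iterates on Q have reached the normal form N, so have those on P. Thus
all normal forms of P are the eventual value of one sequence. -/
theorem AppSteps.exists_dev_iterate {Γ Δ T} {P N : Tm σ Γ Δ T} (h : AppSteps P N)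
    (hN : N.BetaNormal) : ∃ n₀, ∀ n ≥ n₀, Tm.dev^[n] P = N := by
  induction h using Relation.ReflTransGen.head_induction_on with
  | refl => exact ⟨0, fun n _ => hN.dev_iterate n⟩
  | @head P Q hPQ _ ih =>
    obtain ⟨n₀, h⟩ := ih
    refine ⟨n₀ + 1, fun n hn => ?_⟩
    obtain ⟨n, rfl⟩ : ∃ i, n = i + 1 := ⟨n - 1, by omega⟩
    have := (InSubterm.parRed hPQ).triangle.dev_iterate n
    rw [h n (by omega)] at this
    exact hN.eq_of_parRed this

theorem AppSteps.bnf_eq {Γ Δ T} {P N : Tm σ Γ Δ T} (h : AppSteps P N) (hN : N.BetaNormal) :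
    P.bnf = N := by
  obtain ⟨n, hn⟩ := h.exists_dev_iterate hN
  obtain ⟨m, hm⟩ := P.appSteps_bnf.exists_dev_iterate P.betaNormal_bnf
  rw [← hn (n + m) (by omega), hm (n + m) (by omega)]

theorem AppSteps.bnf_eq_bnf {Γ Δ T} {P Q : Tm σ Γ Δ T} (h : AppSteps P Q) : P.bnf = Q.bnf :=
  AppSteps.bnf_eq (h.trans Q.appSteps_bnf) Q.betaNormal_bnf

theorem Tm.BetaNormal.bnf_eq {Γ Δ T} {P : Tm σ Γ Δ T} (h : P.BetaNormal) : P.bnf = P :=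
  AppSteps.bnf_eq .refl h

theorem Tm.bnf_inp {Γ Δ} {k : σ.NSort} (m : Name σ Δ k) (P : Tm σ (σ.obj k :: Γ) Δ .proc) :
    (Tm.inp m P).bnf = .inp m P.bnf :=
  AppSteps.bnf_eq (AppSteps.inp m P.appSteps_bnf) P.betaNormal_bnf

theorem Tm.bnf_out {Γ Δ} {k : σ.NSort} (m : Name σ Δ k) (P : Tm σ Γ Δ (σ.obj k)) :
    (Tm.out m P).bnf = .out m P.bnf :=
  AppSteps.bnf_eq (AppSteps.out m P.appSteps_bnf) P.betaNormal_bnf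

theorem Tm.bnf_par {Γ Δ} (P Q : Tm σ Γ Δ .proc) : (Tm.par P Q).bnf = .par P.bnf Q.bnf :=
  AppSteps.bnf_eq (AppSteps.par P.appSteps_bnf Q.appSteps_bnf)
    ⟨P.betaNormal_bnf, Q.betaNormal_bnf⟩

theorem Tm.bnf_pabs {Γ Δ S} (P : Tm σ (S :: Γ) Δ .proc) : (Tm.pabs P).bnf = .pabs P.bnf :=
  AppSteps.bnf_eq (AppSteps.pabs P.appSteps_bnf) P.betaNormal_bnf

theorem Tm.bnf_nabs {Γ Δ k} (P : Tm σ Γ (k :: Δ) .proc) : (Tm.nabs P).bnf = .nabs P.bnf :=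
  AppSteps.bnf_eq (AppSteps.nabs P.appSteps_bnf) P.betaNormal_bnf

theorem Tm.bnf_papp_var {Γ Δ S} (x : Var Γ (.pabs S)) (P : Tm σ Γ Δ S) :
    (Tm.papp (.var x) P).bnf = .papp (.var x) P.bnf :=
  AppSteps.bnf_eq (AppSteps.papp .refl P.appSteps_bnf) ⟨id, P.betaNormal_bnf⟩

/-- Both normal forms are reached after a common number of developments, and each development
preserves the congruence. -/
theorem Cong.bnf {B : TRel σ} (hB : Stable B) {Γ Δ T} {P Q : Tm σ Γ Δ T} (h : Cong B P Q) :
    Cong B P.bnf Q.bnf := by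
  obtain ⟨n, hn⟩ := P.appSteps_bnf.exists_dev_iterate P.betaNormal_bnf
  obtain ⟨m, hm⟩ := Q.appSteps_bnf.exists_dev_iterate Q.betaNormal_bnf
  rw [← hn (n + m) (by omega), ← hm (n + m) (by omega)]
  generalize n + m = i
  clear hn hm
  induction i generalizing P Q with
  | zero => exact h
  | succ i ih => exact ih (h.dev hB)

/-- Terms related by stable laws and the application laws have normal forms related by the stable
laws alone. -/
theorem Cong.bnf_of_appLaw {B B' : TRel σ} (hB : Stable B)
    (hB' : ∀ {Γ Δ T} {P Q : Tm σ Γ Δ T}, B' P Q → B P Q ∨ AppLaw P Q)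
    {Γ Δ T} {P Q : Tm σ Γ Δ T} (h : Cong B' P Q) : Cong B P.bnf Q.bnf := by
  induction h with
  | base h =>
    rcases hB' h with h | h
    · exact (Cong.base h).bnf hB
    · rw [AppSteps.bnf_eq_bnf (.single (.here h))]
      exact .refl _
  | refl P => exact .refl _
  | symm _ ih => exact ih.symm
  | trans _ _ ih₁ ih₂ => exact ih₁.trans ih₂
  | inp m _ ih => rw [Tm.bnf_inp, Tm.bnf_inp]; exact ih.inp m
  | out m _ ih => rw [Tm.bnf_out, Tm.bnf_out]; exact ih.out m
  | par _ _ ih₁ ih₂ => rw [Tm.bnf_par, Tm.bnf_par]; exact ih₁.par ih₂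
  | pabs _ ih => rw [Tm.bnf_pabs, Tm.bnf_pabs]; exact ih.pabs
  | @papp _ _ _ P P' Q Q' _ _ ih₁ ih₂ =>
    -- The normal form of an application is not built from those of its parts. The parts are
    -- normalized first, which yields applications related by `B` alone, and `Cong.bnf` finishes.
    rw [AppSteps.bnf_eq_bnf (AppSteps.papp P.appSteps_bnf Q.appSteps_bnf),
      AppSteps.bnf_eq_bnf (AppSteps.papp P'.appSteps_bnf Q'.appSteps_bnf)]
    exact (ih₁.papp ih₂).bnf hB
  | nabs _ ih => rw [Tm.bnf_nabs, Tm.bnf_nabs]; exact ih.nabs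
  | @napp _ _ _ P P' n _ ih =>
    rw [AppSteps.bnf_eq_bnf (AppSteps.napp n P.appSteps_bnf),
      AppSteps.bnf_eq_bnf (AppSteps.napp n P'.appSteps_bnf)]
    exact (ih.napp n).bnf hB

theorem InSubterm.cong {B : TRel σ} {Γ Δ T} {P Q : Tm σ Γ Δ T} (h : InSubterm B P Q) :
    Cong B P Q := by
  induction h with
  | here h => exact .base h
  | inp m _ ih => exact .inp m ih
  | out m _ ih => exact .out m ih
  | parL Q _ ih => exact .par ih (.refl _)
  | parR P _ ih => exact .par (.refl _) ih
  | pabs _ ih => exact .pabs ih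
  | pappL Q _ ih => exact .papp ih (.refl _)
  | pappR P _ ih => exact .papp (.refl _) ih
  | nabs _ ih => exact .nabs ih
  | napp n _ ih => exact .napp n ih

theorem SCongr.mCongr_bnf {Γ Δ T} {P Q : Tm σ Γ Δ T} (h : SCongr P Q) : MCongr P.bnf Q.bnf :=
  Cong.bnf_of_appLaw stable_monoidLaw id h

theorem AxEq.bnf {Γ Δ T} {P Q : Tm σ Γ Δ T} (h : AxEq P Q) : Cong MonoidDisLaw P.bnf Q.bnf :=
  Cong.bnf_of_appLaw stable_monoidDisLaw or_assoc.2 h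

theorem MCongr.sCongr {Γ Δ T} {P Q : Tm σ Γ Δ T} (h : MCongr P Q) : SCongr P Q :=
  Cong.mono Or.inl h

theorem SCongr.axEq {Γ Δ T} {P Q : Tm σ Γ Δ T} (h : SCongr P Q) : AxEq P Q :=
  Cong.mono (Or.imp_right Or.inr) h

theorem axEq_of_monoidDisLaw {Γ Δ T} {P Q : Tm σ Γ Δ T} (h : Cong MonoidDisLaw P Q) : AxEq P Q :=
  Cong.mono (Or.imp_right Or.inl) h

theorem AppSteps.sCongr {Γ Δ T} {P Q : Tm σ Γ Δ T} (h : AppSteps P Q) : SCongr P Q := by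
  induction h with
  | refl => exact .refl _
  | tail _ h ih => exact ih.trans (Cong.mono Or.inr h.cong)

theorem Tm.sCongr_bnf {Γ Δ T} (P : Tm σ Γ Δ T) : SCongr P P.bnf :=
  P.appSteps_bnf.sCongr

end BetaNormal

/-! ### Matching of prime parallel factors -/

section Factors

variable {σ : Sorting.{u}}

/-- The process is neither `0` nor a parallel composition. -/
def Tm.IsPrime {Γ : List (Ty σ.NSort)} {Δ : List σ.NSort} {T : Ty σ.NSort} : Tm σ Γ Δ T → Prop
  | .nil => False
  | .par _ _ => False
  | _ => True

/-- `Factor P F R`: the process `P` is a parallel composition with a prime component `F`, and `R` is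
obtained from `P` by replacing this component by `0`. -/
inductive Factor {Γ : List (Ty σ.NSort)} {Δ : List σ.NSort} :
    ∀ {T : Ty σ.NSort}, Tm σ Γ Δ T → Tm σ Γ Δ .proc → Tm σ Γ Δ .proc → Prop
  | here {F : Tm σ Γ Δ .proc} : F.IsPrime → Factor F F .nil
  | parL {P F R : Tm σ Γ Δ .proc} (Q : Tm σ Γ Δ .proc) :
      Factor P F R → Factor (.par P Q) F (.par R Q)
  | parR {Q F R : Tm σ Γ Δ .proc} (P : Tm σ Γ Δ .proc) :
      Factor Q F R → Factor (.par P Q) F (.par P R)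

/-- `FactorMatch S F R F' R'`: the prime processes `F` and `F'` have the same form, and, up to `S`,
their components are related and so are the remaining processes `R` and `R'`. For inputs, the
processes reached by the input are related. -/
inductive FactorMatch (S : TRel σ) {Γ : List (Ty σ.NSort)} {Δ : List σ.NSort} :
    Tm σ Γ Δ .proc → Tm σ Γ Δ .proc → Tm σ Γ Δ .proc → Tm σ Γ Δ .proc → Prop
  | inp {k : σ.NSort} (m : Name σ Δ k) {A B R R'} :
      S (.par A R.wkP) (.par B R'.wkP) → FactorMatch S (.inp m A) R (.inp m B) R'
  | out {k : σ.NSort} (m : Name σ Δ k) {A B R R'} :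
      S A B → S R R' → FactorMatch S (.out m A) R (.out m B) R'
  | var (X : Var Γ .proc) {R R'} : S R R' → FactorMatch S (.var X) R (.var X) R'
  | papp {T} {P P' : Tm σ Γ Δ (.pabs T)} {A B R R'} :
      S P P' → S A B → S R R' → FactorMatch S (.papp P A) R (.papp P' B) R'
  | napp {k} {P P' : Tm σ Γ Δ (.nabs k)} (n : Name σ Δ k) {R R'} :
      S P P' → S R R' → FactorMatch S (.napp P n) R (.napp P' n) R'

/-- Every prime factor of `P` is matched by a prime factor of `Q`. -/
def FactorSim (S : TRel σ) {Γ Δ T} (P Q : Tm σ Γ Δ T) : Prop :=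
  ∀ ⦃F R⦄, Factor P F R → ∃ F' R', Factor Q F' R' ∧ FactorMatch S F R F' R'

theorem Factor.isPrime {Γ Δ T} {P : Tm σ Γ Δ T} {F R : Tm σ Γ Δ .proc} (h : Factor P F R) :
    F.IsPrime := by
  induction h with
  | here h => exact h
  | parL _ _ ih => exact ih
  | parR _ _ ih => exact ih

theorem FactorMatch.trans {S : TRel σ}
    (hS : ∀ {Γ Δ T} {P Q R : Tm σ Γ Δ T}, S P Q → S Q R → S P R) {Γ Δ}
    {F₁ R₁ F₂ R₂ F₃ R₃ : Tm σ Γ Δ .proc} (h : FactorMatch S F₁ R₁ F₂ R₂)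
    (h' : FactorMatch S F₂ R₂ F₃ R₃) : FactorMatch S F₁ R₁ F₃ R₃ := by
  cases h with
  | inp m h => cases h' with | inp _ h' => exact .inp m (hS h h')
  | out m h₁ h₂ => cases h' with | out _ h₁' h₂' => exact .out m (hS h₁ h₁') (hS h₂ h₂')
  | var X h => cases h' with | var _ h' => exact .var X (hS h h')
  | papp h₁ h₂ h₃ =>
    cases h' with | papp h₁' h₂' h₃' => exact .papp (hS h₁ h₁') (hS h₂ h₂') (hS h₃ h₃')
  | napp n h₁ h₂ => cases h' with | napp _ h₁' h₂' => exact .napp n (hS h₁ h₁') (hS h₂ h₂')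

theorem FactorSim.trans {S : TRel σ}
    (hS : ∀ {Γ Δ T} {P Q R : Tm σ Γ Δ T}, S P Q → S Q R → S P R) {Γ Δ T}
    {P Q R : Tm σ Γ Δ T} (h : FactorSim S P Q) (h' : FactorSim S Q R) : FactorSim S P R := by
  intro F E hF
  obtain ⟨F', E', hF', hm⟩ := h hF
  obtain ⟨F'', E'', hF'', hm'⟩ := h' hF'
  exact ⟨F'', E'', hF'', FactorMatch.trans (S := S) hS hm hm'⟩

theorem FactorMatch.mono {S S' : TRel σ} (hS : ∀ {Γ Δ T} {P Q : Tm σ Γ Δ T}, S P Q → S' P Q)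
    {Γ Δ} {F R F' R' : Tm σ Γ Δ .proc} (h : FactorMatch S F R F' R') :
    FactorMatch S' F R F' R' := by
  cases h with
  | inp m h => exact .inp m (hS h)
  | out m h₁ h₂ => exact .out m (hS h₁) (hS h₂)
  | var X h => exact .var X (hS h)
  | papp h₁ h₂ h₃ => exact .papp (hS h₁) (hS h₂) (hS h₃)
  | napp n h₁ h₂ => exact .napp n (hS h₁) (hS h₂)

theorem Factor.copies {Γ Δ} {n : ℕ} {P F R : Tm σ Γ Δ .proc} (hP : P.IsPrime)
    (h : Factor (Tm.copies n P) F R) : F = P ∧ ∃ i, n = i + 1 ∧ MCongr R (Tm.copies i P) := by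
  induction n generalizing R with
  | zero => cases h with | here h => exact h.elim
  | succ n ih =>
    cases h with
    | here h => exact h.elim
    | parL _ h =>
      cases h with
      | here => exact ⟨rfl, n, rfl, .trans (.base (.comm _ _)) (.base (.unit _))⟩
      | parL => exact hP.elim
      | parR => exact hP.elim
    | parR _ h =>
      obtain ⟨rfl, i, rfl, h'⟩ := ih h
      exact ⟨rfl, i + 1, rfl, .par (.refl _) h'⟩

section

variable {B : TRel σ} (hB : Stable B)
include hB

theorem FactorMatch.of_rest {Γ Δ} {F R R' : Tm σ Γ Δ .proc} (hF : F.IsPrime)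
    (h : Cong B R R') : FactorMatch (Cong B) F R F R' := by
  cases F with
  | nil => exact hF.elim
  | par => exact hF.elim
  | var x => exact .var x h
  | inp m A => exact .inp m ((Cong.refl _).par (h.wkP hB))
  | out m A => exact .out m (.refl _) h
  | papp P A => exact .papp (.refl _) (.refl _) h
  | napp P n => exact .napp n (.refl _) h

theorem FactorMatch.rest_trans {Γ Δ} {F R F' R' R₁ R₁' : Tm σ Γ Δ .proc}
    (h₁ : Cong B R₁ R) (hF : FactorMatch (Cong B) F R F' R') (h : Cong B R' R₁')
    (hp : F.IsPrime) (hp' : F'.IsPrime) : FactorMatch (Cong B) F R₁ F' R₁' :=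
  ((FactorMatch.of_rest hB hp h₁).trans Cong.trans hF).trans Cong.trans
    (FactorMatch.of_rest hB hp' h)

theorem FactorSim.of_rest {Γ Δ T} {P Q : Tm σ Γ Δ T}
    (h : ∀ ⦃F R⦄, Factor P F R → ∃ R', Factor Q F R' ∧ Cong B R R') :
    FactorSim (Cong B) P Q := by
  intro F R hF
  obtain ⟨R', h₁, h₂⟩ := h hF
  exact ⟨F, R', h₁, .of_rest hB hF.isPrime h₂⟩

variable (hM : ∀ {Γ Δ T} {P Q : Tm σ Γ Δ T}, MonoidLaw P Q → B P Q)
include hM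

theorem FactorMatch.par {Γ Δ} {F R F' R' Q Q' : Tm σ Γ Δ .proc}
    (hF : FactorMatch (Cong B) F R F' R') (h : Cong B Q Q') :
    FactorMatch (Cong B) F (.par R Q) F' (.par R' Q') := by
  cases hF with
  | inp m hA =>
    exact .inp m (.trans (.symm (.base (hM (.assoc _ _ _))))
      ((hA.par (h.wkP hB)).trans (.base (hM (.assoc _ _ _)))))
  | out m h₁ h₂ => exact .out m h₁ (h₂.par h)
  | var X h₁ => exact .var X (h₁.par h)
  | papp h₁ h₂ h₃ => exact .papp h₁ h₂ (h₃.par h)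
  | napp n h₁ h₂ => exact .napp n h₁ (h₂.par h)

theorem FactorSim.monoidLaw {Γ Δ T} {P Q : Tm σ Γ Δ T} (h : MonoidLaw P Q) :
    FactorSim (Cong B) P Q ∧ FactorSim (Cong B) Q P := by
  have hb : ∀ {Γ Δ T} {P Q : Tm σ Γ Δ T}, MonoidLaw P Q → Cong B P Q := fun h => .base (hM h)
  constructor <;> refine FactorSim.of_rest hB fun F R hF => ?_
  · cases h with
    | assoc P Q R =>
      cases hF with
      | here h => exact h.elim
      | parL _ h =>
        cases h with
        | here h => exact h.elim
        | parL _ h => exact ⟨_, .parL _ h, hb (.assoc _ _ _)⟩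
        | parR _ h => exact ⟨_, .parR _ (.parL _ h), hb (.assoc _ _ _)⟩
      | parR _ h => exact ⟨_, .parR _ (.parR _ h), hb (.assoc _ _ _)⟩
    | comm P Q =>
      cases hF with
      | here h => exact h.elim
      | parL _ h => exact ⟨_, .parR _ h, hb (.comm _ _)⟩
      | parR _ h => exact ⟨_, .parL _ h, hb (.comm _ _)⟩
    | unit P =>
      cases hF with
      | here h => exact h.elim
      | parL _ h => exact ⟨_, h, hb (.unit _)⟩
      | parR _ h => cases h with | here h => exact h.elim
  · cases h with
    | assoc P Q R =>
      cases hF with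
      | here h => exact h.elim
      | parL _ h => exact ⟨_, .parL _ (.parL _ h), .symm (hb (.assoc _ _ _))⟩
      | parR _ h =>
        cases h with
        | here h => exact h.elim
        | parL _ h => exact ⟨_, .parL _ (.parR _ h), .symm (hb (.assoc _ _ _))⟩
        | parR _ h => exact ⟨_, .parR _ h, .symm (hb (.assoc _ _ _))⟩
    | comm P Q =>
      cases hF with
      | here h => exact h.elim
      | parL _ h => exact ⟨_, .parR _ h, hb (.comm _ _)⟩
      | parR _ h => exact ⟨_, .parL _ h, hb (.comm _ _)⟩
    | unit P => exact ⟨_, .parL _ hF, .symm (hb (.unit _))⟩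

theorem FactorSim.par {Γ Δ} {P P' Q Q' : Tm σ Γ Δ .proc} (hP : Cong B P P') (hQ : Cong B Q Q')
    (h₁ : FactorSim (Cong B) P P') (h₂ : FactorSim (Cong B) Q Q') :
    FactorSim (Cong B) (.par P Q) (.par P' Q') := by
  intro F R hF
  cases hF with
  | here h => exact h.elim
  | parL _ h =>
    obtain ⟨F', R', h', hm⟩ := h₁ h
    exact ⟨F', _, .parL _ h', hm.par hB hM hQ⟩
  | parR _ h =>
    obtain ⟨F', R', h', hm⟩ := h₂ h
    have hc : ∀ {P Q : Tm σ Γ Δ .proc}, Cong B (.par P Q) (.par Q P) := .base (hM (.comm _ _))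
    exact ⟨F', _, .parR _ h', .rest_trans hB hc (hm.par hB hM hP) hc h.isPrime h'.isPrime⟩

/-- Congruent processes have matching prime factors. -/
theorem Cong.factorSim
    (hF : ∀ {Γ Δ T} {P Q : Tm σ Γ Δ T}, B P Q → FactorSim (Cong B) P Q ∧ FactorSim (Cong B) Q P)
    {Γ Δ T} {P Q : Tm σ Γ Δ T} (h : Cong B P Q) :
    FactorSim (Cong B) P Q ∧ FactorSim (Cong B) Q P := by
  have hu : ∀ {Γ Δ} {P Q : Tm σ Γ Δ .proc}, Cong B P Q → Cong B (.par P .nil) (.par Q .nil) :=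
    fun h => h.par (.refl _)
  induction h with
  | base h => exact hF h
  | refl P =>
    have : FactorSim (Cong B) P P := .of_rest hB fun F R h => ⟨R, h, .refl _⟩
    exact ⟨this, this⟩
  -- Both directions are carried through the induction because symmetry exchanges them.
  | symm _ ih => exact ih.symm
  | trans _ _ ih₁ ih₂ => exact ⟨ih₁.1.trans Cong.trans ih₂.1, ih₂.2.trans Cong.trans ih₁.2⟩
  | inp m h ih =>
    constructor <;> intro F R hF <;> cases hF
    · exact ⟨_, _, .here trivial, .inp m (hu h)⟩
    · exact ⟨_, _, .here trivial, .inp m (hu h.symm)⟩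
  | out m h ih =>
    constructor <;> intro F R hF <;> cases hF
    · exact ⟨_, _, .here trivial, .out m h (.refl _)⟩
    · exact ⟨_, _, .here trivial, .out m h.symm (.refl _)⟩
  | par h₁ h₂ ih₁ ih₂ =>
    exact ⟨.par hB hM h₁ h₂ ih₁.1 ih₂.1, .par hB hM h₁.symm h₂.symm ih₁.2 ih₂.2⟩
  | papp h₁ h₂ ih =>
    constructor <;> intro F R hF <;> cases hF
    · exact ⟨_, _, .here trivial, .papp h₁ h₂ (.refl _)⟩
    · exact ⟨_, _, .here trivial, .papp h₁.symm h₂.symm (.refl _)⟩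
  | napp n h ih =>
    constructor <;> intro F R hF <;> cases hF
    · exact ⟨_, _, .here trivial, .napp n h (.refl _)⟩
    · exact ⟨_, _, .here trivial, .napp n h.symm (.refl _)⟩
  | pabs => constructor <;> intro F R hF <;> cases hF
  | nabs => constructor <;> intro F R hF <;> cases hF

end

theorem MCongr.factorSim {Γ Δ T} {P Q : Tm σ Γ Δ T} (h : MCongr P Q) : FactorSim MCongr P Q :=
  (Cong.factorSim stable_monoidLaw id (FactorSim.monoidLaw stable_monoidLaw id) h).1

theorem Tm.wkP_copies {Γ Δ S} (n : ℕ) (P : Tm σ Γ Δ .proc) :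
    (Tm.copies n P).wkP (S := S) = Tm.copies n P.wkP := by
  simp only [Tm.wkP, Tm.ren_eq_msub, Tm.msub_copies]

theorem Factor.copies_succ {Γ Δ} (n : ℕ) {P : Tm σ Γ Δ .proc} (hP : P.IsPrime) :
    Factor (Tm.copies (n + 1) P) P (.par .nil (Tm.copies n P)) :=
  .parL _ (.here hP)

/-- An input from either side of DIS leads to P in parallel with k-1 copies of m(X).P. On the left
the copies come from the body, on the right they are the remaining factors. -/
theorem FactorSim.disLaw {Γ Δ T} {P Q : Tm σ Γ Δ T} (h : DisLaw P Q) :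
    FactorSim (Cong MonoidDisLaw) P Q ∧ FactorSim (Cong MonoidDisLaw) Q P := by
  cases h with
  | @dis _ _ s m P k hk =>
  obtain ⟨i, rfl⟩ : ∃ i, k = i + 1 := ⟨k - 1, by omega⟩
  have hM : ∀ {Γ Δ T} {P Q : Tm σ Γ Δ T}, MCongr P Q → Cong MonoidDisLaw P Q := Cong.mono Or.inl
  have hw : ∀ {R : Tm σ _ _ _}, MCongr R (Tm.copies i (.inp m P)) → MCongr
      (.par (.par P (Tm.copies i (Tm.inp m P).wkP)) (Tm.wkP (S := σ.obj s) .nil))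
      (.par P R.wkP) := by
    intro R hR
    refine (Cong.base (.unit _)).trans (.par (.refl _) ?_)
    rw [← Tm.wkP_copies]
    exact (Cong.wkP stable_monoidLaw hR).symm
  constructor
  · intro F R hF
    cases hF
    exact ⟨_, _, .copies_succ i trivial,
      .inp m (hM (hw (.trans (.base (.comm _ _)) (.base (.unit _)))))⟩
  · intro F R hF
    obtain ⟨rfl, j, hj, h⟩ := Factor.copies (P := .inp m P) trivial hF
    obtain rfl : i = j := by omega
    exact ⟨_, _, .here trivial, .inp m (hM (hw h).symm)⟩

theorem factorSim_monoidDisLaw {Γ Δ T} {P Q : Tm σ Γ Δ T} (h : Cong MonoidDisLaw P Q) :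
    FactorSim (Cong MonoidDisLaw) P Q :=
  (Cong.factorSim stable_monoidDisLaw Or.inl (fun h => h.elim
    (FactorSim.monoidLaw stable_monoidDisLaw Or.inl) FactorSim.disLaw) h).1

end Factors

/-! ### Transitions as factors, soundness, and bisimilarity -/

section Transitions

variable {σ : Sorting.{u}}

theorem Factor.exists_mCongr {Γ Δ T} {P : Tm σ Γ Δ T} {F R : Tm σ Γ Δ .proc} (h : Factor P F R) :
    ∃ hT : T = .proc, MCongr (hT ▸ P) (.par F R) := by
  induction h with
  | here => exact ⟨rfl, (Cong.base (.unit _)).symm⟩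
  | parL Q _ ih =>
    obtain ⟨_, ih⟩ := ih
    exact ⟨rfl, (ih.par (.refl _)).trans (.base (.assoc _ _ _))⟩
  | parR P _ ih =>
    obtain ⟨_, ih⟩ := ih
    exact ⟨rfl, (Cong.base (.comm _ _)).trans ((ih.par (.refl _)).trans
      ((Cong.base (.assoc _ _ _)).trans (.par (.refl _) (.base (.comm _ _)))))⟩

theorem Factor.mCongr {Γ Δ} {P F R : Tm σ Γ Δ .proc} (h : Factor P F R) : MCongr P (.par F R) :=
  h.exists_mCongr.2

theorem SCongr.wkP {Γ Δ T S} {P Q : Tm σ Γ Δ T} (h : SCongr P Q) :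
    SCongr (P.wkP (S := S)) Q.wkP := by
  simp only [Tm.wkP, Tm.ren_eq_msub]
  refine Cong.msub ?_ h _ _
  intro Γ Δ T P Q h Γ' Δ' θ ν
  refine h.imp (fun h => stable_monoidLaw.msub h θ ν) fun h => ?_
  cases h with
  | app1 P Q => rw [Tm.msub_psubst]; exact .app1 _ _
  | app2 P m => rw [Tm.msub_nsubst]; exact .app2 _ _

theorem Factor.outTr {Γ Δ} {P R : Tm σ Γ Δ .proc} {k} {m : Name σ Δ k} {A : Tm σ Γ Δ (σ.obj k)}
    (h : Factor P (.out m A) R) : OutTr m A P R :=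
  .struct h.mCongr.sCongr (.parL R .out) (.trans (.base (.inl (.comm _ _)))
    (.base (.inl (.unit _))))

theorem Factor.inpTr {Γ Δ} {P R : Tm σ Γ Δ .proc} {k} {m : Name σ Δ k}
    {A : Tm σ (σ.obj k :: Γ) Δ .proc} (h : Factor P (.inp m A) R) : InpTr m P (.par A R.wkP) :=
  .struct h.mCongr.sCongr (.parL R (.inp A)) (.refl _)

/-- Inversion of transitions, with closure under `≡` absorbed: on beta-normal forms `≡` becomes
monoid congruence, which matches prime factors. `InpTr.exists_factor` is the analogue for inputs. -/
theorem OutTr.exists_factor {Γ Δ} {P P' : Tm σ Γ Δ .proc} {k} {m : Name σ Δ k}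
    {A : Tm σ Γ Δ (σ.obj k)} (h : OutTr m A P P') :
    ∃ A' R, Factor P.bnf (.out m A') R ∧ SCongr A A' ∧ SCongr P' R := by
  induction h with
  | out => rw [Tm.bnf_out]; exact ⟨A.bnf, .nil, .here trivial, A.sCongr_bnf, .refl _⟩
  | parL Q _ ih =>
    obtain ⟨A', R, h₁, h₂, h₃⟩ := ih
    rw [Tm.bnf_par]
    exact ⟨A', _, .parL _ h₁, h₂, h₃.par Q.sCongr_bnf⟩
  | parR P _ ih =>
    obtain ⟨A', R, h₁, h₂, h₃⟩ := ih
    rw [Tm.bnf_par]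
    exact ⟨A', _, .parR _ h₁, h₂, P.sCongr_bnf.par h₃⟩
  | struct h _ h' ih =>
    obtain ⟨A', R, h₁, h₂, h₃⟩ := ih
    obtain ⟨F', R', hF, hm⟩ := MCongr.factorSim (Cong.symm h.mCongr_bnf) h₁
    cases hm with
    | out _ h₄ h₅ =>
      exact ⟨_, _, hF, h₂.trans h₄.sCongr, h'.symm.trans (h₃.trans h₅.sCongr)⟩

theorem InpTr.exists_factor {Γ Δ} {P : Tm σ Γ Δ .proc} {k} {m : Name σ Δ k}
    {P' : Tm σ (σ.obj k :: Γ) Δ .proc} (h : InpTr m P P') :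
    ∃ A R, Factor P.bnf (.inp m A) R ∧ SCongr P' (.par A R.wkP) := by
  induction h with
  | inp P =>
    rw [Tm.bnf_inp]
    exact ⟨P.bnf, .nil, .here trivial,
      P.sCongr_bnf.trans (.symm (.base (.inl (.unit _))))⟩
  | parL Q _ ih =>
    obtain ⟨A, R, h₁, h₂⟩ := ih
    rw [Tm.bnf_par]
    exact ⟨A, _, .parL _ h₁,
      (h₂.par Q.sCongr_bnf.wkP).trans (.base (.inl (.assoc _ _ _)))⟩
  | parR P _ ih =>
    obtain ⟨A, R, h₁, h₂⟩ := ih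
    rw [Tm.bnf_par]
    exact ⟨A, _, .parR _ h₁,
      (P.sCongr_bnf.wkP.par h₂).trans ((Cong.base (.inl (.comm _ _))).trans
        ((Cong.base (.inl (.assoc _ _ _))).trans (.par (.refl _) (.base (.inl (.comm _ _))))))⟩
  | struct h _ h' ih =>
    obtain ⟨A, R, h₁, h₂⟩ := ih
    obtain ⟨F', R', hF, hm⟩ := MCongr.factorSim (Cong.symm h.mCongr_bnf) h₁
    cases hm with
    | inp _ h₄ => exact ⟨_, _, hF, h'.symm.trans (h₂.trans h₄.sCongr)⟩

/-- The same inversion for the clauses of bisimulation that exhibit a variable, or an application of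
one, as a parallel component. -/
theorem SCongr.exists_factor {Γ Δ} {P F P' : Tm σ Γ Δ .proc} (h : SCongr P (.par F P'))
    (hF : F.bnf.IsPrime) :
    ∃ F' R, Factor P.bnf F' R ∧ FactorMatch MCongr F.bnf P'.bnf F' R := by
  have h' := h.mCongr_bnf
  rw [Tm.bnf_par] at h'
  obtain ⟨F', R, h₁, h₂⟩ := MCongr.factorSim (Cong.symm h') (.parL _ (.here hF))
  exact ⟨F', R, h₁, .rest_trans stable_monoidLaw
    (.trans (.symm (.base (.unit _))) (.base (.comm _ _))) h₂ (.refl _) hF h₁.isPrime⟩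

theorem Factor.sCongr {Γ Δ} {P F R : Tm σ Γ Δ .proc} (h : Factor P.bnf F R) :
    SCongr P (.par F R) :=
  P.sCongr_bnf.trans h.mCongr.sCongr

theorem SCongr.headMatch {Γ Δ T} {P Q : Tm σ Γ Δ T} (h : SCongr P Q) : HeadMatch SCongr P Q :=
  Cong.headMatch (fun h => by rcases h with h | h <;> cases h <;> rfl) h

theorem AxEq.headMatch {Γ Δ T} {P Q : Tm σ Γ Δ T} (h : AxEq P Q) : HeadMatch AxEq P Q :=
  Cong.headMatch (fun h => by rcases h with h | h | h <;> cases h <;> rfl) h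

theorem Tm.not_isAbs_proc {Γ Δ} (P : Tm σ Γ Δ .proc) : ¬ P.IsAbs := by
  cases P <;> exact id

theorem AxEq.factor {Γ Δ} {P Q F R : Tm σ Γ Δ .proc} (h : AxEq P Q) (hF : Factor P.bnf F R) :
    ∃ F' R', Factor Q.bnf F' R' ∧ FactorMatch AxEq F R F' R' := by
  obtain ⟨F', R', h₁, h₂⟩ := factorSim_monoidDisLaw h.bnf hF
  exact ⟨F', R', h₁, h₂.mono axEq_of_monoidDisLaw⟩

theorem AxEq.factor_of_sCongr {Γ Δ} {P Q F P' : Tm σ Γ Δ .proc} (h : AxEq P Q)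
    (hF : F.bnf.IsPrime) (hP : SCongr P (.par F P')) :
    ∃ F' R', SCongr Q (.par F' R') ∧ FactorMatch AxEq F.bnf P'.bnf F' R' := by
  obtain ⟨F', R', h₁, h₂⟩ := hP.exists_factor hF
  obtain ⟨F'', R'', h₃, h₄⟩ := h.factor h₁
  exact ⟨F'', R'', h₃.sCongr, (h₂.mono fun h => h.sCongr.axEq).trans Cong.trans h₄⟩

/-- Provable equality is a strong HO-IO bisimulation. -/
theorem isHOIOBisim_axEq : IsHOIOBisim (AxEq (σ := σ)) where
  symm h := Cong.symm h
  nonabs h hP := by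
    cases h.headMatch with
    | proc => exact Tm.not_isAbs_proc _
    | var => exact id
    | pabs => exact hP
    | nabs => exact hP
  pabs h := by cases h.headMatch with | pabs h' => exact ⟨_, rfl, h'⟩
  nabs h := by cases h.headMatch with | nabs h' => exact ⟨_, rfl, h'⟩
  out h _ m A P' hP := by
    obtain ⟨A', R, h₁, h₂, h₃⟩ := hP.exists_factor
    obtain ⟨F, R', h₄, h₅⟩ := AxEq.factor h h₁
    cases h₅ with
    | out _ h₅ h₆ =>
      exact ⟨_, R', .struct (Tm.sCongr_bnf _) h₄.outTr (.refl _), h₂.axEq.trans h₅,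
        h₃.axEq.trans h₆⟩
  inp h _ m P' hP := by
    obtain ⟨A, R, h₁, h₂⟩ := hP.exists_factor
    obtain ⟨F, R', h₃, h₄⟩ := AxEq.factor h h₁
    cases h₄ with
    | inp _ h₄ => exact ⟨_, .struct (Tm.sCongr_bnf _) h₃.inpTr (.refl _), h₂.axEq.trans h₄⟩
  var {Γ Δ _ _} h X P' hP := by
    have hX : (Tm.var (σ := σ) (Δ := Δ) X).bnf = .var X := Tm.BetaNormal.bnf_eq (P := .var X) trivial
    obtain ⟨F, R, h₁, h₂⟩ := AxEq.factor_of_sCongr h (hX.symm ▸ trivial) hP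
    rw [hX] at h₂
    cases h₂ with
    | var _ h₂ => exact ⟨R, h₁, P'.sCongr_bnf.axEq.trans h₂⟩
  varAbs X Q hT h := by
    cases h.headMatch with
    | proc => exact (hT rfl).elim
    | var => exact .refl _
  varPapp h S X A P' hP := by
    have hX := Tm.bnf_papp_var X A
    obtain ⟨F, R, h₁, h₂⟩ := AxEq.factor_of_sCongr h (hX.symm ▸ trivial) hP
    rw [hX] at h₂
    cases h₂ with
    | papp h₂ h₃ h₄ =>
      -- A term provably equal to a variable of abstraction type is that variable, so the matching
      -- factor has the same head.
      cases h₂.headMatch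
      exact ⟨_, R, h₁, A.sCongr_bnf.axEq.trans h₃, P'.sCongr_bnf.axEq.trans h₄⟩
  varNapp h k X n P' hP := by
    have hX : (Tm.napp (.var X) n).bnf = .napp (.var X) n :=
      Tm.BetaNormal.bnf_eq (P := .napp (.var X) n) id
    obtain ⟨F, R, h₁, h₂⟩ := AxEq.factor_of_sCongr h (hX.symm ▸ trivial) hP
    rw [hX] at h₂
    cases h₂ with
    | napp _ h₂ h₃ =>
      cases h₂.headMatch
      exact ⟨R, h₁, P'.sCongr_bnf.axEq.trans h₃⟩

theorem AxEq.bisim {Γ Δ T} {P Q : Tm σ Γ Δ T} (h : AxEq P Q) : Bisim P Q :=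
  ⟨AxEq, isHOIOBisim_axEq, h⟩

theorem isHOIOBisim_bisim : IsHOIOBisim (Bisim (σ := σ)) where
  symm := fun ⟨R, hR, h⟩ => ⟨R, hR, hR.symm h⟩
  nonabs := fun ⟨_, hR, h⟩ => hR.nonabs h
  pabs := fun ⟨R, hR, h⟩ => (hR.pabs h).imp fun _ h => ⟨h.1, R, hR, h.2⟩
  nabs := fun ⟨R, hR, h⟩ => (hR.nabs h).imp fun _ h => ⟨h.1, R, hR, h.2⟩
  out := fun ⟨R, hR, h⟩ _ m A P' hP =>
    (hR.out h m A P' hP).imp fun _ h => h.imp fun _ h => ⟨h.1, ⟨R, hR, h.2.1⟩, R, hR, h.2.2⟩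
  inp := fun ⟨R, hR, h⟩ _ m P' hP => (hR.inp h m P' hP).imp fun _ h => ⟨h.1, R, hR, h.2⟩
  var := fun ⟨R, hR, h⟩ X P' hP => (hR.var h X P' hP).imp fun _ h => ⟨h.1, R, hR, h.2⟩
  varAbs := fun X _ hT ⟨_, hR, h⟩ => hR.varAbs X hT h
  varPapp := fun ⟨R, hR, h⟩ _ X A P' hP =>
    (hR.varPapp h X A P' hP).imp fun _ h => h.imp fun _ h => ⟨h.1, ⟨R, hR, h.2.1⟩, R, hR, h.2.2⟩
  varNapp := fun ⟨R, hR, h⟩ _ X n P' hP =>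
    (hR.varNapp h X n P' hP).imp fun _ h => ⟨h.1, R, hR, h.2⟩

theorem Bisim.symm {Γ Δ T} {P Q : Tm σ Γ Δ T} (h : Bisim P Q) : Bisim Q P :=
  isHOIOBisim_bisim.symm h

/-- Serves to make bisimilarity transitive. Composing it with itself is symmetric because both
halves are the same symmetric relation. -/
theorem isHOIOBisim_comp : IsHOIOBisim (σ := σ) fun _ _ _ P R => ∃ Q, Bisim P Q ∧ Bisim Q R where
  symm := fun ⟨Q, h, h'⟩ => ⟨Q, h'.symm, h.symm⟩
  nonabs := fun ⟨_, h, h'⟩ hP => isHOIOBisim_bisim.nonabs h' (isHOIOBisim_bisim.nonabs h hP)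
  pabs := by
    rintro Γ Δ S A R ⟨Q, h, h'⟩
    obtain ⟨B, rfl, hAB⟩ := isHOIOBisim_bisim.pabs h
    obtain ⟨C, rfl, hBC⟩ := isHOIOBisim_bisim.pabs h'
    exact ⟨C, rfl, B, hAB, hBC⟩
  nabs := by
    rintro Γ Δ S A R ⟨Q, h, h'⟩
    obtain ⟨B, rfl, hAB⟩ := isHOIOBisim_bisim.nabs h
    obtain ⟨C, rfl, hBC⟩ := isHOIOBisim_bisim.nabs h'
    exact ⟨C, rfl, B, hAB, hBC⟩
  out := by
    rintro Γ Δ P R ⟨Q, h, h'⟩ k m A P' hP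
    obtain ⟨B, Q', hQ, hAB, hPQ⟩ := isHOIOBisim_bisim.out h m A P' hP
    obtain ⟨C, R', hR, hBC, hQR⟩ := isHOIOBisim_bisim.out h' m B Q' hQ
    exact ⟨C, R', hR, ⟨B, hAB, hBC⟩, Q', hPQ, hQR⟩
  inp := by
    rintro Γ Δ P R ⟨Q, h, h'⟩ k m P' hP
    obtain ⟨Q', hQ, hPQ⟩ := isHOIOBisim_bisim.inp h m P' hP
    obtain ⟨R', hR, hQR⟩ := isHOIOBisim_bisim.inp h' m Q' hQ
    exact ⟨R', hR, Q', hPQ, hQR⟩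
  var := by
    rintro Γ Δ P R ⟨Q, h, h'⟩ X P' hP
    obtain ⟨Q', hQ, hPQ⟩ := isHOIOBisim_bisim.var h X P' hP
    obtain ⟨R', hR, hQR⟩ := isHOIOBisim_bisim.var h' X Q' hQ
    exact ⟨R', hR, Q', hPQ, hQR⟩
  varAbs := by
    rintro Γ Δ T X R hT ⟨Q, h, h'⟩
    cases (isHOIOBisim_bisim.varAbs X hT h).headMatch with
    | proc => exact (hT rfl).elim
    | var => exact isHOIOBisim_bisim.varAbs X hT h'
  varPapp := by
    rintro Γ Δ P R ⟨Q, h, h'⟩ S X A P' hP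
    obtain ⟨B, Q', hQ, hAB, hPQ⟩ := isHOIOBisim_bisim.varPapp h X A P' hP
    obtain ⟨C, R', hR, hBC, hQR⟩ := isHOIOBisim_bisim.varPapp h' X B Q' hQ
    exact ⟨C, R', hR, ⟨B, hAB, hBC⟩, Q', hPQ, hQR⟩
  varNapp := by
    rintro Γ Δ P R ⟨Q, h, h'⟩ k X n P' hP
    obtain ⟨Q', hQ, hPQ⟩ := isHOIOBisim_bisim.varNapp h X n P' hP
    obtain ⟨R', hR, hQR⟩ := isHOIOBisim_bisim.varNapp h' X n Q' hQ
    exact ⟨R', hR, Q', hPQ, hQR⟩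

theorem Bisim.trans {Γ Δ T} {P Q R : Tm σ Γ Δ T} (h : Bisim P Q) (h' : Bisim Q R) : Bisim P R :=
  ⟨_, isHOIOBisim_comp, Q, h, h'⟩

theorem SCongr.bisim {Γ Δ T} {P Q : Tm σ Γ Δ T} (h : SCongr P Q) : Bisim P Q :=
  h.axEq.bisim

theorem Factor.betaNormal {Γ Δ T} {P : Tm σ Γ Δ T} {F R : Tm σ Γ Δ .proc} (h : Factor P F R)
    (hP : P.BetaNormal) : F.BetaNormal ∧ R.BetaNormal := by
  induction h with
  | here => exact ⟨hP, trivial⟩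
  | parL Q _ ih => exact ⟨(ih hP.1).1, (ih hP.1).2, hP.2⟩
  | parR P _ ih => exact ⟨(ih hP.2).1, hP.1, (ih hP.2).2⟩

/-- Bisimilar processes without application redexes have matching prime factors. -/
theorem Bisim.factorSim {Γ Δ} {P Q : Tm σ Γ Δ .proc} (h : Bisim P Q) (hP : P.BetaNormal)
    (hQ : Q.BetaNormal) : FactorSim Bisim P Q := by
  intro F R hF
  have hstr : ∀ {F Q'}, SCongr Q (.par F Q') → F.BetaNormal → F.IsPrime →
      ∃ F' R', Factor Q F' R' ∧ FactorMatch MCongr F Q'.bnf F' R' := by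
    intro F Q' h hF hF'
    rw [← hQ.bnf_eq, ← hF.bnf_eq]
    rw [← hF.bnf_eq] at hF'
    rw [hF.bnf_eq]
    exact hF.bnf_eq ▸ h.exists_factor hF'
  cases F with
  | nil => exact hF.isPrime.elim
  | par => exact hF.isPrime.elim
  | var X =>
    obtain ⟨Q', h₁, h₂⟩ := isHOIOBisim_bisim.var h X R hF.mCongr.sCongr
    obtain ⟨F', R', h₃, h₄⟩ := hstr h₁ trivial trivial
    cases h₄ with
    | var _ h₄ =>
      exact ⟨_, R', h₃, .var X (h₂.trans (Q'.sCongr_bnf.bisim.trans h₄.sCongr.bisim))⟩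
  | inp m A =>
    obtain ⟨Q', h₁, h₂⟩ := isHOIOBisim_bisim.inp h m _ hF.inpTr
    obtain ⟨B, R', h₃, h₄⟩ := h₁.exists_factor
    rw [hQ.bnf_eq] at h₃
    exact ⟨_, R', h₃, .inp m (h₂.trans h₄.bisim)⟩
  | out m A =>
    obtain ⟨A', Q', h₁, h₂, h₃⟩ := isHOIOBisim_bisim.out h m _ _ hF.outTr
    obtain ⟨B, R', h₄, h₅, h₆⟩ := h₁.exists_factor
    rw [hQ.bnf_eq] at h₄
    exact ⟨_, R', h₄, .out m (h₂.trans h₅.bisim) (h₃.trans h₆.bisim)⟩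
  | papp P A =>
    have hN := (hF.betaNormal hP).1
    obtain ⟨X, rfl⟩ := Tm.eq_var_of_not_isAbs_pabs hN.1
    obtain ⟨B, Q', h₁, h₂, h₃⟩ := isHOIOBisim_bisim.varPapp h X A R hF.mCongr.sCongr
    -- The bisimulation clause gives an arbitrary argument `B`, whereas `hstr` needs a beta-normal
    -- factor.
    have h₁' : SCongr Q (.par (.papp (.var X) B.bnf) Q') :=
      h₁.trans (.par (.papp (.refl _) B.sCongr_bnf) (.refl _))
    obtain ⟨F', R', h₄, h₅⟩ := hstr h₁' ⟨id, B.betaNormal_bnf⟩ trivial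
    cases h₅ with
    | papp h₅ h₆ h₇ =>
      exact ⟨_, R', h₄, .papp h₅.sCongr.bisim
        (h₂.trans (B.sCongr_bnf.bisim.trans h₆.sCongr.bisim))
        (h₃.trans (Q'.sCongr_bnf.bisim.trans h₇.sCongr.bisim))⟩
  | napp P n =>
    have hN := (hF.betaNormal hP).1
    obtain ⟨X, rfl⟩ := Tm.eq_var_of_not_isAbs_nabs hN
    obtain ⟨Q', h₁, h₂⟩ := isHOIOBisim_bisim.varNapp h X n R hF.mCongr.sCongr
    obtain ⟨F', R', h₃, h₄⟩ := hstr h₁ id trivial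
    cases h₄ with
    | napp _ h₄ h₅ =>
      exact ⟨_, R', h₃, .napp n h₄.sCongr.bisim
        (h₂.trans (Q'.sCongr_bnf.bisim.trans h₅.sCongr.bisim))⟩

end Transitions

/-! ### Counting in multisets of prefixes -/

section PrefixSystem

/-- A set `C` of components with labels in `M` and bodies, which are multisets of components in an
extended context. Components are smaller than the components whose body they belong to. -/
structure PrefixSystem (C M : Type u) (C' : M → Type u) where
  wk : ∀ m, C → C' m
  wk_injective : ∀ m, Function.Injective (wk m)
  Body : C → ∀ m, Multiset (C' m) → Prop
  size : C → ℕ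
  label_unique : ∀ {c m m' a a'}, Body c m a → Body c m' a' → m = m'
  body_unique : ∀ {c m a a'}, Body c m a → Body c m a' → a = a'
  body_injective : ∀ {c d m a}, Body c m a → Body d m a → c = d
  wk_notMem : ∀ {c d m a}, Body c m a → size c ≤ size d → wk m d ∉ a

namespace PrefixSystem

variable {C M : Type u} {C' : M → Type u} [DecidableEq C] (𝒮 : PrefixSystem C M C')

/-- Every component of `p` has a body, and replacing it by its body is matched by `q`. -/
def Sim (p q : Multiset C) : Prop :=
  (∀ c ∈ p, ∃ m a, 𝒮.Body c m a) ∧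
    ∀ c ∈ p, ∀ m a, 𝒮.Body c m a → ∃ d ∈ q, ∃ b, 𝒮.Body d m b ∧
      a + (p.erase c).map (𝒮.wk m) = b + (q.erase d).map (𝒮.wk m)

variable {𝒮} {p q : Multiset C} {F : C}

/-- A component at least as large as `c` cannot occur, weakened, in the body of `c`, so every
occurrence comes from the context `r`. -/
theorem count_body [∀ m, DecidableEq (C' m)] {c : C} {m : M} {a : Multiset (C' m)}
    (hc : 𝒮.Body c m a) (h : 𝒮.size c ≤ 𝒮.size F) (r : Multiset C) :
    (a + r.map (𝒮.wk m)).count (𝒮.wk m F) = r.count F := by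
  rw [Multiset.count_add, Multiset.count_eq_zero_of_notMem (𝒮.wk_notMem hc h), zero_add,
    Multiset.count_map_eq_count' _ _ (𝒮.wk_injective m)]

theorem count_erase_eq (hp : ∀ c ∈ p, 𝒮.size c ≤ 𝒮.size F) (hq : ∀ c ∈ q, 𝒮.size c ≤ 𝒮.size F)
    {c d : C} {m : M} {a b : Multiset (C' m)} (hc : c ∈ p) (hd : d ∈ q) (hca : 𝒮.Body c m a)
    (hdb : 𝒮.Body d m b)
    (h : a + (p.erase c).map (𝒮.wk m) = b + (q.erase d).map (𝒮.wk m)) :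
    (p.erase c).count F = (q.erase d).count F := by
  classical
  have := congrArg (Multiset.count (𝒮.wk m F)) h
  rwa [count_body hca (hp c hc), count_body hdb (hq d hd)] at this

theorem eq_of_erase_match {m : M} {a b : Multiset (C' m)} (hF : F ∈ p) (hF' : F ∈ q)
    (ha : 𝒮.Body F m a) (hb : 𝒮.Body F m b)
    (h : a + (p.erase F).map (𝒮.wk m) = b + (q.erase F).map (𝒮.wk m)) : p = q := by
  obtain rfl := 𝒮.body_unique ha hb
  have := Multiset.map_injective (𝒮.wk_injective m) (add_left_cancel h)
  rw [← Multiset.cons_erase hF, ← Multiset.cons_erase hF', this]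

/-- Expanding F on the left removes one occurrence of F and adds none. The match must do the same,
so it expands F as well, and the common body cancels. -/
theorem Sim.eq_of_count_eq (hpq : 𝒮.Sim p q) (hp : ∀ c ∈ p, 𝒮.size c ≤ 𝒮.size F)
    (hq : ∀ c ∈ q, 𝒮.size c ≤ 𝒮.size F) (hF : F ∈ p) (h : p.count F = q.count F) : p = q := by
  obtain ⟨m, a, ha⟩ := hpq.1 F hF
  obtain ⟨d, hd, b, hb, hab⟩ := hpq.2 F hF m a ha
  have hcount := count_erase_eq hp hq hF hd ha hb hab
  have hpos := Multiset.count_pos.2 hF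
  rw [Multiset.count_erase_self] at hcount
  by_cases hdF : d = F
  · subst hdF
    exact eq_of_erase_match hF hd ha hb hab
  · rw [Multiset.count_erase_of_ne (Ne.symm hdF)] at hcount
    omega

/-- The only component of `p` is an expansion of the components of `q`, which are all equal. -/
def Expands (𝒮 : PrefixSystem C M C') (p q : Multiset C) : Prop :=
  ∃ F G m a b n, p = {F} ∧ q = Multiset.replicate (n + 2) G ∧ 𝒮.Body F m a ∧ 𝒮.Body G m b ∧
    a = b + Multiset.replicate (n + 1) (𝒮.wk m G)

/-- The excess of F on the left forces every move of `p` to consume F and every move of `q` to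
expand something else. This collapses `p` to F and makes the components of `q` equal. -/
theorem Sim.expands_of_count_lt (hpq : 𝒮.Sim p q) (hqp : 𝒮.Sim q p)
    (hp : ∀ c ∈ p, 𝒮.size c ≤ 𝒮.size F) (hq : ∀ c ∈ q, 𝒮.size c ≤ 𝒮.size F)
    (h : q.count F < p.count F) : 𝒮.Expands p q := by
  classical
  have hF : F ∈ p := Multiset.count_pos.1 (by omega)
  -- Expanding another component would leave all occurrences of F in `p`, more than `q` can keep.
  have hall : ∀ c ∈ p, c = F := by
    intro c hc
    by_contra hcF
    obtain ⟨m, a, ha⟩ := hpq.1 c hc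
    obtain ⟨d, hd, b, hb, hab⟩ := hpq.2 c hc m a ha
    have hcount := count_erase_eq hp hq hc hd ha hb hab
    rw [Multiset.count_erase_of_ne (Ne.symm hcF)] at hcount
    have := Multiset.count_le_of_le F (Multiset.erase_le d q)
    omega
  obtain ⟨m, a, ha⟩ := hpq.1 F hF
  -- If F were in `q`, its expansion there would be matched by F in `p`, and cancelling the bodies
  -- would give equal multisets.
  have hFq : F ∉ q := by
    intro hFq
    obtain ⟨d, hd, b, hb, hab⟩ := hqp.2 F hFq m a ha
    obtain rfl := hall d hd
    have := eq_of_erase_match hFq hF ha hb hab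
    subst this
    omega
  obtain ⟨G, hG, b, hb, hab⟩ := hpq.2 F hF m a ha
  have hpF : p = {F} := by
    have hcount := count_erase_eq hp hq hF hG ha hb hab
    rw [Multiset.count_erase_self, Multiset.count_eq_zero_of_notMem
      fun h => hFq (Multiset.mem_of_mem_erase h)] at hcount
    have hrep := Multiset.eq_replicate_card.2 hall
    have hcard : p.count F = p.card := Multiset.count_eq_card.2 fun x hx => (hall x hx).symm
    have hpos := Multiset.count_pos.2 hF
    rw [hrep, show p.card = 1 by omega, Multiset.replicate_one]
  subst hpF
  -- As F is the only component of `p`, each component of `q` splits the one body `a` of F in its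
  -- own way.
  have hbody : ∀ d ∈ q, ∃ b, 𝒮.Body d m b ∧ a = b + (q.erase d).map (𝒮.wk m) := by
    intro d hd
    obtain ⟨m', b, hb⟩ := hqp.1 d hd
    obtain ⟨c, hc, a', ha', hab'⟩ := hqp.2 d hd m' b hb
    obtain rfl := Multiset.mem_singleton.1 hc
    obtain rfl := 𝒮.label_unique ha ha'
    obtain rfl := 𝒮.body_unique ha ha'
    refine ⟨b, hb, ?_⟩
    rw [hab', Multiset.erase_singleton, Multiset.map_zero, add_zero]
  -- Compare the decompositions of `a` at `c` and at a different `d`: neither body contains the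
  -- weakening of `c`, but the first decomposition has removed one occurrence of `c` and the second
  -- none.
  have hle : ∀ c ∈ q, ∀ d ∈ q, 𝒮.size d ≤ 𝒮.size c → c = d := by
    intro c hc d hd hsz
    by_contra hcd
    obtain ⟨b, hb, hab⟩ := hbody c hc
    obtain ⟨b', hb', hab'⟩ := hbody d hd
    have := congrArg (Multiset.count (𝒮.wk m c)) (hab.symm.trans hab')
    rw [count_body hb le_rfl, count_body hb' hsz, Multiset.count_erase_self,
      Multiset.count_erase_of_ne hcd] at this
    have := Multiset.count_pos.2 hc
    omega
  have hqG : ∀ d ∈ q, d = G := fun d hd => by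
    rcases le_total (𝒮.size d) (𝒮.size G) with h | h
    · exact (hle G hG d hd h).symm
    · exact hle d hd G hG h
  have hrep := Multiset.eq_replicate_card.2 hqG
  obtain ⟨n, hn⟩ : ∃ n, q.card = n + 1 := ⟨q.card - 1, by
    have := Multiset.card_pos_iff_exists_mem.2 ⟨G, hG⟩; omega⟩
  rw [hn] at hrep
  obtain ⟨b, hb, hab⟩ := hbody G hG
  rw [hrep, Multiset.replicate_succ, Multiset.erase_cons_head, Multiset.map_replicate] at hab
  cases n with
  | zero =>
    rw [Multiset.replicate_zero, add_zero] at hab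
    subst hab
    -- With a single copy of G the bodies of F and G agree, so F = G would lie in `q`. Hence there
    -- are at least two copies, as DIS requires.
    exact (hFq (𝒮.body_injective ha hb ▸ hG)).elim
  | succ n => exact ⟨F, G, m, a, b, n, rfl, hrep, ha, hb, hab⟩

/-- Multisets of components that simulate each other are equal, or one expands the other. -/
theorem Sim.eq_or_expands (hpq : 𝒮.Sim p q) (hqp : 𝒮.Sim q p) :
    p = q ∨ 𝒮.Expands p q ∨ 𝒮.Expands q p := by
  by_cases h0 : p + q = 0
  · obtain ⟨rfl, rfl⟩ := add_eq_zero.1 h0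
    exact .inl rfl
  obtain ⟨F, hF, hmax⟩ := (p + q).toFinset.exists_max_image 𝒮.size
    (Multiset.toFinset_nonempty.2 h0)
  simp only [Multiset.mem_toFinset, Multiset.mem_add] at hF hmax
  have hp : ∀ c ∈ p, 𝒮.size c ≤ 𝒮.size F := fun c hc => hmax c (.inl hc)
  have hq : ∀ c ∈ q, 𝒮.size c ≤ 𝒮.size F := fun c hc => hmax c (.inr hc)
  rcases lt_trichotomy (p.count F) (q.count F) with h | h | h
  · exact .inr (.inr (hqp.expands_of_count_lt hpq hq hp h))
  · rcases hF with hF | hF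
    · exact .inl (hpq.eq_of_count_eq hp hq hF h)
    · exact .inl (hqp.eq_of_count_eq hq hp hF h.symm).symm
  · exact .inr (.inl (hpq.expands_of_count_lt hqp hp hq h))

end PrefixSystem

end PrefixSystem

/-! ### Processes as multisets of prime components -/

section Components

variable {σ : Sorting.{u}}

/-- Processes up to the commutative monoid laws. -/
def mCongrSetoid (σ : Sorting.{u}) (Γ : List (Ty σ.NSort)) (Δ : List σ.NSort) :
    Setoid (Tm σ Γ Δ .proc) where
  r P Q := MCongr P Q
  iseqv := ⟨Cong.refl, Cong.symm, Cong.trans⟩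

/-- The commutative monoid of processes up to the commutative monoid laws. -/
def ProcClass (σ : Sorting.{u}) (Γ : List (Ty σ.NSort)) (Δ : List σ.NSort) : Type u :=
  Quotient (mCongrSetoid σ Γ Δ)

/-- The class of a process. -/
def Tm.cls {Γ Δ} (P : Tm σ Γ Δ .proc) : ProcClass σ Γ Δ :=
  Quotient.mk (mCongrSetoid σ Γ Δ) P

theorem Tm.cls_eq_iff {Γ Δ} {P Q : Tm σ Γ Δ .proc} : P.cls = Q.cls ↔ MCongr P Q :=
  Quotient.eq (r := mCongrSetoid σ Γ Δ)

instance {Γ Δ} : AddCommMonoid (ProcClass σ Γ Δ) where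
  add := Quotient.map₂ Tm.par fun _ _ h _ _ h' => Cong.par h h'
  zero := Tm.nil.cls
  add_assoc := by
    rintro ⟨P⟩ ⟨Q⟩ ⟨R⟩
    exact Tm.cls_eq_iff.2 (.base (.assoc _ _ _))
  add_comm := by
    rintro ⟨P⟩ ⟨Q⟩
    exact Tm.cls_eq_iff.2 (.base (.comm _ _))
  add_zero := by
    rintro ⟨P⟩
    exact Tm.cls_eq_iff.2 (.base (.unit _))
  zero_add := by
    rintro ⟨P⟩
    exact Tm.cls_eq_iff.2 ((Cong.base (.comm _ _)).trans (.base (.unit _)))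
  nsmul := @nsmulRec _ ⟨Tm.nil.cls⟩ ⟨Quotient.map₂ Tm.par fun _ _ h _ _ h' => Cong.par h h'⟩

theorem Tm.cls_par {Γ Δ} (P Q : Tm σ Γ Δ .proc) : (Tm.par P Q).cls = P.cls + Q.cls := rfl

/-- The multiset of the prime components of a process, up to the commutative monoid laws. -/
def Tm.components {Γ : List (Ty σ.NSort)} {Δ : List σ.NSort} {T : Ty σ.NSort} :
    Tm σ Γ Δ T → Multiset (ProcClass σ Γ Δ)
  | .nil => 0
  | .var (T := .proc) x => {(Tm.var x).cls}
  | .var _ => 0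
  | .inp m P => {(Tm.inp m P).cls}
  | .out m Q => {(Tm.out m Q).cls}
  | .par P Q => P.components + Q.components
  | .pabs _ => 0
  | .papp P Q => {(Tm.papp P Q).cls}
  | .nabs _ => 0
  | .napp P n => {(Tm.napp P n).cls}

theorem Tm.IsPrime.components_eq {Γ Δ} {F : Tm σ Γ Δ .proc} (h : F.IsPrime) :
    F.components = {F.cls} := by
  cases F with
  | nil => exact h.elim
  | par => exact h.elim
  | var | inp | out | papp | napp => rfl

theorem MCongr.components_eq {Γ Δ T} {P Q : Tm σ Γ Δ T} (h : MCongr P Q) :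
    P.components = Q.components := by
  induction h with
  | base h =>
    cases h with
    | assoc => exact add_assoc _ _ _
    | comm => exact add_comm _ _
    | unit => exact add_zero _
  | refl P => rfl
  | symm _ ih => exact ih.symm
  | trans _ _ ih₁ ih₂ => exact ih₁.trans ih₂
  | inp m h ih => exact congrArg (fun c => ({c} : Multiset _)) (Tm.cls_eq_iff.2 (.inp m h))
  | out m h ih => exact congrArg (fun c => ({c} : Multiset _)) (Tm.cls_eq_iff.2 (.out m h))
  | par _ _ ih₁ ih₂ => exact congrArg₂ _ ih₁ ih₂
  | pabs _ ih => rfl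
  | papp h h' _ _ => exact congrArg (fun c => ({c} : Multiset _)) (Tm.cls_eq_iff.2 (.papp h h'))
  | nabs _ ih => rfl
  | napp n h ih => exact congrArg (fun c => ({c} : Multiset _)) (Tm.cls_eq_iff.2 (.napp n h))

theorem Tm.sum_components {Γ Δ} : ∀ P : Tm σ Γ Δ .proc, P.components.sum = P.cls
  | .nil => Multiset.sum_zero
  | .par P Q => by
    rw [Tm.components, Multiset.sum_add, Tm.sum_components P, Tm.sum_components Q, Tm.cls_par]
  | .var _ => Multiset.sum_singleton _
  | .inp _ _ => Multiset.sum_singleton _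
  | .out _ _ => Multiset.sum_singleton _
  | .papp _ _ => Multiset.sum_singleton _
  | .napp _ _ => Multiset.sum_singleton _

/-- The components sum to the class of the process in the commutative monoid `ProcClass`, so they
form a complete invariant. -/
theorem Tm.mCongr_of_components_eq {Γ Δ} {P Q : Tm σ Γ Δ .proc}
    (h : P.components = Q.components) : MCongr P Q := by
  rw [← Tm.cls_eq_iff, ← Tm.sum_components, ← Tm.sum_components, h]

theorem Factor.components_eq {Γ Δ T} {P : Tm σ Γ Δ T} {F R : Tm σ Γ Δ .proc} (h : Factor P F R) :
    P.components = F.cls ::ₘ R.components := by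
  induction h with
  | here h => exact h.components_eq
  | parL Q _ ih => simp only [Tm.components, ih, Multiset.cons_add]
  | parR P _ ih => simp only [Tm.components, ih, Multiset.add_cons]

theorem Tm.exists_factor_of_mem_components {Γ Δ} {c : ProcClass σ Γ Δ} :
    ∀ {P : Tm σ Γ Δ .proc}, c ∈ P.components → ∃ F R, Factor P F R ∧ F.cls = c
  | .nil, h => (Multiset.notMem_zero _ h).elim
  | .par P Q, h => by
    rcases Multiset.mem_add.1 h with h | h
    · obtain ⟨F, R, h₁, h₂⟩ := Tm.exists_factor_of_mem_components h
      exact ⟨F, _, .parL _ h₁, h₂⟩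
    · obtain ⟨F, R, h₁, h₂⟩ := Tm.exists_factor_of_mem_components h
      exact ⟨F, _, .parR _ h₁, h₂⟩
  | .var _, h => ⟨_, _, .here trivial, (Multiset.mem_singleton.1 h).symm⟩
  | .inp _ _, h => ⟨_, _, .here trivial, (Multiset.mem_singleton.1 h).symm⟩
  | .out _ _, h => ⟨_, _, .here trivial, (Multiset.mem_singleton.1 h).symm⟩
  | .papp _ _, h => ⟨_, _, .here trivial, (Multiset.mem_singleton.1 h).symm⟩
  | .napp _ _, h => ⟨_, _, .here trivial, (Multiset.mem_singleton.1 h).symm⟩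

/-- Weakening of classes of processes. -/
def ProcClass.wkP {Γ Δ} {S : Ty σ.NSort} : ProcClass σ Γ Δ → ProcClass σ (S :: Γ) Δ :=
  Quotient.map Tm.wkP fun _ _ h => Cong.wkP stable_monoidLaw h

theorem Tm.components_wkP {Γ Δ} {S : Ty σ.NSort} :
    ∀ P : Tm σ Γ Δ .proc, (P.wkP (S := S)).components = P.components.map ProcClass.wkP
  | .nil => rfl
  | .par P Q => by
    refine (congrArg₂ _ (Tm.components_wkP P) (Tm.components_wkP Q)).trans ?_
    exact (Multiset.map_add _ _ _).symm
  | .var _ => rfl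
  | .inp _ _ => rfl
  | .out _ _ => rfl
  | .papp _ _ => rfl
  | .napp _ _ => rfl

theorem Tm.components_copies {Γ Δ} (n : ℕ) {P : Tm σ Γ Δ .proc} (hP : P.IsPrime) :
    (Tm.copies n P).components = Multiset.replicate n P.cls := by
  induction n with
  | zero => rfl
  | succ n ih =>
    simp only [Tm.copies, Tm.components, ih, hP.components_eq, Multiset.replicate_succ,
      Multiset.singleton_add]

/-- A closed term of the given type. -/
def Tm.inhabitant {Γ : List (Ty σ.NSort)} {Δ : List σ.NSort} : ∀ T : Ty σ.NSort, Tm σ Γ Δ T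
  | .proc => .nil
  | .pabs _ => .pabs .nil
  | .nabs _ => .nabs .nil

/-- Every type has a closed inhabitant, and substituting it for the new variable undoes the
weakening. -/
theorem ProcClass.wkP_injective {Γ Δ} {S : Ty σ.NSort} :
    Function.Injective (ProcClass.wkP (σ := σ) (Γ := Γ) (Δ := Δ) (S := S)) := by
  rintro ⟨P⟩ ⟨Q⟩ h
  have h' : MCongr (P.wkP (S := S)) Q.wkP := Tm.cls_eq_iff.1 h
  have := Cong.psubst stable_monoidLaw h' (.refl (Tm.inhabitant S))
  rw [Tm.psubst_wkP, Tm.psubst_wkP] at this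
  exact Tm.cls_eq_iff.2 this

/-- The sorts of the two names may differ a priori, so the bodies cannot be compared directly. The
concluding equation of terms lets a case split identify sorts and names. -/
theorem MCongr.inp_inj {Γ Δ} {k k' : σ.NSort} {m : Name σ Δ k} {m' : Name σ Δ k'}
    {A : Tm σ (σ.obj k :: Γ) Δ .proc} {B : Tm σ (σ.obj k' :: Γ) Δ .proc}
    (h : MCongr (.inp m A) (.inp m' B)) : ∃ A', MCongr A A' ∧ Tm.inp m A' = .inp m' B := by
  obtain ⟨F, R, hF, hm⟩ := h.factorSim (.here trivial)
  cases hF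
  cases hm with
  | inp _ h => exact ⟨_, (Cong.base (.unit _)).symm.trans (h.trans (.base (.unit _))), rfl⟩

/-- The number of constructors other than `0` and parallel composition. -/
def Tm.size {Γ : List (Ty σ.NSort)} {Δ : List σ.NSort} {T : Ty σ.NSort} : Tm σ Γ Δ T → ℕ
  | .nil => 0
  | .var _ => 1
  | .inp _ P => P.size + 1
  | .out _ Q => Q.size + 1
  | .par P Q => P.size + Q.size
  | .pabs P => P.size + 1
  | .papp P Q => P.size + Q.size + 1
  | .nabs P => P.size + 1
  | .napp P _ => P.size + 1

theorem MCongr.size_eq {Γ Δ T} {P Q : Tm σ Γ Δ T} (h : MCongr P Q) : P.size = Q.size := by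
  induction h with
  | base h => cases h <;> simp only [Tm.size] <;> omega
  | refl P => rfl
  | symm _ ih => exact ih.symm
  | trans _ _ ih₁ ih₂ => exact ih₁.trans ih₂
  | inp | out | par | pabs | papp | nabs | napp => simp only [Tm.size, *]

theorem Tm.size_ren {Γ Δ T} (P : Tm σ Γ Δ T) {Γ' Δ'} (ρ : PRen σ Γ Γ') (ν : NSub σ Δ Δ') :
    (P.ren ρ ν).size = P.size := by
  induction P generalizing Γ' Δ' <;> simp only [Tm.ren, Tm.size, *]

theorem Factor.size_eq {Γ Δ T} {P : Tm σ Γ Δ T} {F R : Tm σ Γ Δ .proc} (h : Factor P F R) :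
    P.size = F.size + R.size := by
  induction h with
  | here => rfl
  | parL | parR => simp only [Tm.size]; omega

/-- The size of a class of processes. -/
def ProcClass.size {Γ Δ} : ProcClass σ Γ Δ → ℕ :=
  Quotient.lift Tm.size fun _ _ h => MCongr.size_eq h

theorem ProcClass.size_wkP {Γ Δ} {S : Ty σ.NSort} (c : ProcClass σ Γ Δ) :
    (c.wkP (S := S)).size = c.size := by
  obtain ⟨P⟩ := c
  exact Tm.size_ren P _ _

/-- Classes of processes, with the inputs as the components that have a body. -/
def inputSystem (σ : Sorting.{u}) (Γ : List (Ty σ.NSort)) (Δ : List σ.NSort) :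
    PrefixSystem (ProcClass σ Γ Δ) ((k : σ.NSort) × Name σ Δ k)
      (fun m => ProcClass σ (σ.obj m.1 :: Γ) Δ) where
  wk _ := ProcClass.wkP
  wk_injective _ := ProcClass.wkP_injective
  Body c m a := ∃ A, c = (Tm.inp m.2 A).cls ∧ a = A.components
  size := ProcClass.size
  label_unique := by
    rintro _ ⟨k, m⟩ ⟨k', m'⟩ _ _ ⟨A, rfl, rfl⟩ ⟨B, h, rfl⟩
    obtain ⟨B', -, h'⟩ := (Tm.cls_eq_iff.1 h).inp_inj
    cases h'
    rfl
  body_unique := by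
    rintro _ ⟨k, m⟩ _ _ ⟨A, rfl, rfl⟩ ⟨B, h, rfl⟩
    obtain ⟨B', h₁, h'⟩ := (Tm.cls_eq_iff.1 h).inp_inj
    cases h'
    exact h₁.components_eq
  body_injective := by
    rintro _ _ ⟨k, m⟩ _ ⟨A, rfl, rfl⟩ ⟨B, rfl, h⟩
    exact Tm.cls_eq_iff.2 (.inp m (Tm.mCongr_of_components_eq h))
  wk_notMem := by
    rintro _ d ⟨k, m⟩ _ ⟨A, rfl, rfl⟩ hsz hmem
    -- A prime factor of the body is no larger than the body, hence smaller than the input;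
    -- weakening does not change size.
    obtain ⟨F, R, hF, hd⟩ := Tm.exists_factor_of_mem_components hmem
    have h₁ := congrArg ProcClass.size hd
    rw [ProcClass.size_wkP] at h₁
    have h₂ := hF.size_eq
    change A.size + 1 ≤ d.size at hsz
    change F.size = d.size at h₁
    omega

end Components

/-! ### Bisimilar normal terms are congruent -/

section Completeness

variable {σ : Sorting.{u}}

/-- The term has no application redex, and no input in it has a body of the form
`A | ∏ m(X).A` up to the commutative monoid laws. -/
def Tm.Normal {Γ : List (Ty σ.NSort)} {Δ : List σ.NSort} {T : Ty σ.NSort} :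
    Tm σ Γ Δ T → Prop
  | .nil => True
  | .var _ => True
  | .inp m P =>
    P.Normal ∧ ∀ (n : ℕ) (A), ¬ MCongr P (.par A (Tm.copies (n + 1) (Tm.inp m A).wkP))
  | .out _ Q => Q.Normal
  | .par P Q => P.Normal ∧ Q.Normal
  | .pabs P => P.Normal
  | .papp P Q => ¬ P.IsAbs ∧ Q.Normal
  | .nabs P => P.Normal
  | .napp P _ => ¬ P.IsAbs

/-- The context must respect arbitrary laws, as a rewrite step uses the monoid laws around the step
and DIS or an application law within it. -/
theorem IsNormal.of_context {Γ Δ T Γ' Δ' T'} {f : Tm σ Γ Δ T → Tm σ Γ' Δ' T'}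
    (hf : ∀ {B : TRel σ} {P Q}, Cong B P Q → Cong B (f P) (f Q))
    (hf' : ∀ {B : TRel σ} {P Q}, InSubterm B P Q → InSubterm B (f P) (f Q))
    {P : Tm σ Γ Δ T} (h : IsNormal (f P)) : IsNormal P :=
  fun Q ⟨P', Q', h₁, h₂, h₃⟩ => h (f Q) ⟨f P', f Q', hf h₁, hf' h₂, hf h₃⟩

theorem IsNormal.not_law {Γ Δ T} {P : Tm σ Γ Δ T} (h : IsNormal P) {P' Q : Tm σ Γ Δ T}
    (hP : MCongr P P') : ¬ (DisLaw P' Q ∨ AppLaw P' Q) :=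
  fun hQ => h Q ⟨P', Q, hP, .here hQ, .refl _⟩

theorem IsNormal.normal {Γ Δ T} {P : Tm σ Γ Δ T} (h : IsNormal P) : P.Normal := by
  induction P with
  | nil => trivial
  | var x => trivial
  | inp m P ih =>
    exact ⟨ih (h.of_context (.inp m) (.inp m)),
      -- DIS with k = n + 2 has k - 1 = n + 1 inner copies.
      fun n A hA => h.not_law (hA.inp m) (.inl (.dis m A (n + 2) (by omega)))⟩
  | out m Q ih => exact ih (h.of_context (.out m) (.out m))
  | par P Q ihP ihQ =>
    exact ⟨ihP (h.of_context (f := (Tm.par · Q)) (.par · (.refl _)) (.parL _)),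
      ihQ (h.of_context (f := Tm.par P) (.par (.refl _)) (.parR _))⟩
  | pabs P ih => exact ih (h.of_context .pabs .pabs)
  | papp P Q ihP ihQ =>
    refine ⟨fun hP => ?_, ihQ (h.of_context (f := Tm.papp P) (.papp (.refl _)) (.pappR _))⟩
    cases P with
    | var => exact hP
    | pabs A => exact h.not_law (.refl _) (.inr (.app1 A Q))
  | nabs P ih => exact ih (h.of_context .nabs .nabs)
  | napp P n ih =>
    intro hP
    cases P with
    | var => exact hP
    | nabs A => exact h.not_law (.refl _) (.inr (.app2 A n))

theorem Tm.Normal.betaNormal {Γ Δ T} {P : Tm σ Γ Δ T} (h : P.Normal) : P.BetaNormal := by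
  induction P with
  | nil => trivial
  | var x => trivial
  | inp m P ih => exact ih h.1
  | out m Q ih => exact ih h
  | par P Q ihP ihQ => exact ⟨ihP h.1, ihQ h.2⟩
  | pabs P ih => exact ih h
  | papp P Q ihP ihQ => exact ⟨h.1, ihQ h.2⟩
  | nabs P ih => exact ih h
  | napp P n ih => exact h

/-- A renaming with a left inverse preserves normality. -/
theorem Tm.Normal.ren {Γ Δ T} {P : Tm σ Γ Δ T} (h : P.Normal) {Γ'} (ρ : PRen σ Γ Γ')
    (θ : PSub σ Γ' Γ Δ) (hθ : ∀ ⦃T⦄ (x : Var Γ T), θ (ρ x) = .var x) :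
    (P.ren ρ fun _ x => .var x).Normal := by
  have hlift : ∀ {Γ Γ' : List (Ty σ.NSort)} {Δ : List σ.NSort} {S} {ρ : PRen σ Γ Γ'}
      {θ : PSub σ Γ' Γ Δ}, (∀ ⦃T⦄ (x : Var Γ T), θ (ρ x) = .var x) →
        ∀ ⦃T⦄ (x : Var (S :: Γ) T), PSub.liftP θ (PRen.lift ρ x) = .var x := by
    intro Γ Γ' Δ S ρ θ h T x
    cases x with
    | z => rfl
    | s x => simp only [PRen.lift, PSub.liftP, h]; rfl
  induction P generalizing Γ' with
  | nil => trivial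
  | var x => trivial
  | inp m P ih =>
    refine ⟨ih h.1 _ _ (hlift hθ), fun n A hA => ?_⟩
    rw [Name.sub_id] at hA
    -- The left inverse carries a DIS redex of the renamed term back to one of `P`.
    have h' := Cong.msub stable_monoidLaw.msub hA (PSub.liftP θ) (fun _ x => .var x)
    rw [Tm.msub_ren] at h'
    simp only [hlift hθ, Tm.msub, Tm.msub_copies, Tm.msub_wkP, Name.sub_id] at h'
    change MCongr (P.msub _ fun _ x => .var x) _ at h'
    rw [Tm.msub_id] at h'
    exact h.2 n _ h'
  | out m Q ih => exact ih h _ _ hθ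
  | par P Q ihP ihQ => exact ⟨ihP h.1 _ _ hθ, ihQ h.2 _ _ hθ⟩
  | pabs P ih => exact ih h _ _ (hlift hθ)
  | papp P Q ihP ihQ => exact ⟨fun hP => h.1 ((Tm.isAbs_ren _ _).1 hP), ihQ h.2 _ _ hθ⟩
  | nabs P ih =>
    simp only [Tm.ren, NSub.lift_id]
    exact ih h ρ (PSub.liftN θ) fun _ x => by simp only [PSub.liftN, hθ]; rfl
  | napp P n ih => exact fun hP => h ((Tm.isAbs_ren _ _).1 hP)

theorem Tm.Normal.wkP {Γ Δ T S} {P : Tm σ Γ Δ T} (h : P.Normal) : (P.wkP (S := S)).Normal :=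
  h.ren _ (PSub.single (Tm.inhabitant S)) fun _ _ => rfl

theorem Factor.normal {Γ Δ T} {P : Tm σ Γ Δ T} {F R : Tm σ Γ Δ .proc} (h : Factor P F R)
    (hP : P.Normal) : F.Normal ∧ R.Normal := by
  induction h with
  | here => exact ⟨hP, trivial⟩
  | parL Q _ ih => exact ⟨(ih hP.1).1, (ih hP.1).2, hP.2⟩
  | parR P _ ih => exact ⟨(ih hP.2).1, hP.1, (ih hP.2).2⟩

/-- An expanding component is, up to the monoid laws, the left-hand side of DIS. -/
theorem Tm.Normal.not_expands [DecidableEq (ProcClass σ Γ Δ)] {P : Tm σ Γ Δ .proc} (hP : P.Normal)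
    {q : Multiset (ProcClass σ Γ Δ)} : ¬ (inputSystem σ Γ Δ).Expands P.components q := by
  rintro ⟨_, _, ⟨k, m⟩, _, _, n, hp, -, ⟨A, rfl, rfl⟩, ⟨B, rfl, rfl⟩, hAB⟩
  obtain ⟨F, R, hF, hFA⟩ := Tm.exists_factor_of_mem_components (P := P)
    (hp ▸ Multiset.mem_singleton_self _)
  have hN := (hF.normal hP).1
  have hAB' : MCongr A (.par B (Tm.copies (n + 1) (Tm.inp m B).wkP)) := by
    apply Tm.mCongr_of_components_eq
    rw [hAB, Tm.components, Tm.components_copies _ (by trivial)]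
    rfl
  obtain ⟨F', R', hF', hm⟩ := MCongr.factorSim (Cong.symm (Tm.cls_eq_iff.1 hFA))
    (.here (F := .inp m A) trivial)
  cases F with
  | nil => exact hF.isPrime.elim
  | par => exact hF.isPrime.elim
  | var | out | papp | napp => cases hF'; cases hm
  | inp m' A' =>
    obtain ⟨A'', h, h'⟩ := (Tm.cls_eq_iff.1 hFA).inp_inj
    cases h'
    exact hN.2 n B (h.trans hAB')

/-- The term is an input `m(X).P`. -/
def Tm.IsInp {Γ Δ} {T : Ty σ.NSort} : Tm σ Γ Δ T → Prop
  | .inp _ _ => True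
  | _ => False

/-- Passes from bisimilarity to the counting argument. The assumption `hPQ` is the place of the
induction hypothesis: it turns bisimilar processes reached by inputs into equal multisets. -/
theorem FactorSim.sim_components [DecidableEq (ProcClass σ Γ Δ)] {P Q : Tm σ Γ Δ .proc}
    (h : FactorSim Bisim P Q) (hP : ∀ ⦃F R⦄, Factor P F R → F.IsInp)
    (hPQ : ∀ {k} {m : Name σ Δ k} {A B R R'}, Factor P (.inp m A) R → Factor Q (.inp m B) R' →
      Bisim (.par A R.wkP) (.par B R'.wkP) → MCongr (.par A R.wkP) (.par B R'.wkP)) :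
    (inputSystem σ Γ Δ).Sim P.components Q.components := by
  constructor
  · intro c hc
    obtain ⟨F, R, hF, rfl⟩ := Tm.exists_factor_of_mem_components hc
    cases F with
    | inp m A => exact ⟨⟨_, m⟩, _, A, rfl, rfl⟩
    | nil | var | out | par | papp | napp => exact (hP hF).elim
  · rintro c hc ⟨k, m⟩ a ⟨A, rfl, rfl⟩
    obtain ⟨F, R, hF, hFA⟩ := Tm.exists_factor_of_mem_components hc
    cases F with
    | nil | var | out | par | papp | napp => exact (hP hF).elim
    | inp m' A' =>
      obtain ⟨B', h₁, h'⟩ := (Tm.cls_eq_iff.1 hFA).inp_inj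
      cases h'
      obtain ⟨F', R', hF', hm⟩ := h hF
      cases hm with
      | @inp _ _ _ B _ _ hb =>
        refine ⟨_, ?_, _, ⟨B, rfl, rfl⟩, ?_⟩
        · rw [hF'.components_eq]
          exact Multiset.mem_cons_self _ _
        · have := (hPQ hF hF' hb).components_eq
          simp only [Tm.components, Tm.components_wkP] at this
          rw [← hFA, hF.components_eq, hF'.components_eq, Multiset.erase_cons_head,
            Multiset.erase_cons_head, ← h₁.components_eq]
          exact this

/-- For a factor that is not an input, bisimilarity relates components and remainders separately.
All are smaller than P, so the induction hypothesis reassembles both processes. -/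
theorem mCongr_of_factorMatch {Γ Δ} {P Q F R F' R' : Tm σ Γ Δ .proc} (hF : Factor P F R)
    (hF' : Factor Q F' R') (hm : FactorMatch Bisim F R F' R') (hI : ¬ F.IsInp)
    (hP : P.Normal) (hQ : Q.Normal)
    (ih : ∀ {T} {A B : Tm σ Γ Δ T}, A.size < P.size → A.Normal → B.Normal → Bisim A B →
      MCongr A B) : MCongr P Q := by
  have hsz := hF.size_eq
  obtain ⟨hFN, hRN⟩ := hF.normal hP
  obtain ⟨hFN', hRN'⟩ := hF'.normal hQ
  have key : MCongr F F' → Bisim R R' → 0 < F.size → MCongr P Q := fun h hR hs =>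
    hF.mCongr.trans ((Cong.par h (ih (by omega) hRN hRN' hR)).trans (Cong.symm hF'.mCongr))
  cases hm with
  | inp => exact (hI trivial).elim
  | out m h₁ h₂ =>
    exact key (.out m (ih (by simp only [Tm.size] at hsz; omega) hFN hFN' h₁)) h₂
      (by simp only [Tm.size]; omega)
  | var X h => exact key (.refl _) h (by simp only [Tm.size]; omega)
  | papp h₁ h₂ h₃ =>
    obtain ⟨X, rfl⟩ := Tm.eq_var_of_not_isAbs_pabs hFN.1
    exact key (.papp (ih (by simp only [Tm.size] at hsz ⊢; omega) trivial (by
      obtain ⟨Y, rfl⟩ := Tm.eq_var_of_not_isAbs_pabs hFN'.1; trivial) h₁)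
      (ih (by simp only [Tm.size] at hsz; omega) hFN.2 hFN'.2 h₂)) h₃
      (by simp only [Tm.size]; omega)
  | napp n h₁ h₂ =>
    obtain ⟨X, rfl⟩ := Tm.eq_var_of_not_isAbs_nabs hFN
    exact key (.napp n (ih (by simp only [Tm.size] at hsz ⊢; omega) trivial (by
      obtain ⟨Y, rfl⟩ := Tm.eq_var_of_not_isAbs_nabs hFN'; trivial) h₁)) h₂
      (by simp only [Tm.size]; omega)

theorem FactorMatch.isInp_iff {S : TRel σ} {Γ Δ} {F R F' R' : Tm σ Γ Δ .proc}
    (h : FactorMatch S F R F' R') : F.IsInp ↔ F'.IsInp := by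
  cases h <;> exact Iff.rfl

/-- Bisimilar normal terms are equal up to the commutative monoid laws. -/
theorem Bisim.mCongr {Γ Δ T} {P Q : Tm σ Γ Δ T} (h : Bisim P Q) (hP : P.Normal)
    (hQ : Q.Normal) : MCongr P Q := by
  classical
  induction hn : P.size using Nat.strong_induction_on generalizing Γ Δ T with
  | _ n ih =>
  have ih' : ∀ {Γ Δ T} {A B : Tm σ Γ Δ T}, A.size < P.size → A.Normal → B.Normal → Bisim A B →
      MCongr A B := fun hs hA hB hAB => ih _ (hn ▸ hs) hAB hA hB rfl
  cases T with
  | pabs S =>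
    cases P with
    | var X =>
      cases (isHOIOBisim_bisim.varAbs X nofun h).headMatch
      exact .refl _
    | pabs A =>
      obtain ⟨B, rfl, hAB⟩ := isHOIOBisim_bisim.pabs h
      exact .pabs (ih' (Nat.lt_succ_self _) hP hQ hAB)
  | nabs k =>
    cases P with
    | var X =>
      cases (isHOIOBisim_bisim.varAbs X nofun h).headMatch
      exact .refl _
    | nabs A =>
      obtain ⟨B, rfl, hAB⟩ := isHOIOBisim_bisim.nabs h
      exact .nabs (ih' (Nat.lt_succ_self _) hP hQ hAB)
  | proc =>
    have hPQ := h.factorSim hP.betaNormal hQ.betaNormal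
    have hQP := h.symm.factorSim hQ.betaNormal hP.betaNormal
    by_cases hPI : ∀ ⦃F R⦄, Factor P F R → F.IsInp
    swap
    · push Not at hPI
      obtain ⟨F, R, hF, hI⟩ := hPI
      obtain ⟨F', R', hF', hm⟩ := hPQ hF
      exact mCongr_of_factorMatch hF hF' hm hI hP hQ ih'
    have hQI : ∀ ⦃F R⦄, Factor Q F R → F.IsInp := by
      intro F R hF
      obtain ⟨F', R', hF', hm⟩ := hQP hF
      exact hm.isInp_iff.2 (hPI hF')
    have hstep : ∀ {k} {m : Name σ Δ k} {A B R R'}, Factor P (.inp m A) R →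
        Factor Q (.inp m B) R' → Bisim (.par A R.wkP) (.par B R'.wkP) →
        MCongr (.par A R.wkP) (.par B R'.wkP) := by
      intro k m A B R R' hF hF' hb
      obtain ⟨h₁, h₂⟩ := hF.normal hP
      obtain ⟨h₃, h₄⟩ := hF'.normal hQ
      refine ih' ?_ ⟨h₁.1, h₂.wkP⟩ ⟨h₃.1, h₄.wkP⟩ hb
      -- The input consumes one prefix and weakening preserves size, so the process reached is
      -- smaller by one.
      have := hF.size_eq
      simp only [Tm.size, Tm.wkP, Tm.size_ren] at this ⊢
      omega
    rcases (hPQ.sim_components hPI hstep).eq_or_expands (hQP.sim_components hQI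
      fun hF hF' hb => Cong.symm (hstep hF' hF hb.symm)) with h | h | h
    · exact Tm.mCongr_of_components_eq h
    · exact (hP.not_expands h).elim
    · exact (hQ.not_expands h).elim

end Completeness

/-! ### Existence and uniqueness of normal forms -/

section NormalForms

variable {σ : Sorting.{u}}

/-- A weight in which inputs count twice the weight of their body. Rewriting by `DIS` decreases
it. -/
def Tm.weight {Γ : List (Ty σ.NSort)} {Δ : List σ.NSort} {T : Ty σ.NSort} : Tm σ Γ Δ T → ℕ
  | .nil => 0
  | .var _ => 0
  | .inp _ P => 2 * P.weight + 1
  | .out _ Q => Q.weight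
  | .par P Q => P.weight + Q.weight
  | .pabs P => P.weight
  | .papp P Q => P.weight + Q.weight
  | .nabs P => P.weight
  | .napp P _ => P.weight

theorem MCongr.weight_eq {Γ Δ T} {P Q : Tm σ Γ Δ T} (h : MCongr P Q) : P.weight = Q.weight := by
  induction h with
  | base h => cases h <;> simp only [Tm.weight] <;> omega
  | refl P => rfl
  | symm _ ih => exact ih.symm
  | trans _ _ ih₁ ih₂ => exact ih₁.trans ih₂
  | inp | out | par | pabs | papp | nabs | napp => simp only [Tm.weight, *]

theorem Tm.weight_ren {Γ Δ T} (P : Tm σ Γ Δ T) {Γ' Δ'} (ρ : PRen σ Γ Γ') (ν : NSub σ Δ Δ') :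
    (P.ren ρ ν).weight = P.weight := by
  induction P generalizing Γ' Δ' <;> simp only [Tm.ren, Tm.weight, *]

theorem Tm.weight_copies {Γ Δ} (n : ℕ) (P : Tm σ Γ Δ .proc) :
    (Tm.copies n P).weight = n * P.weight := by
  induction n with
  | zero => exact (Nat.zero_mul _).symm
  | succ n ih => rw [Tm.copies, Tm.weight, ih, Nat.succ_mul, Nat.add_comm]

theorem InSubterm.weight_lt {Γ Δ T} {P Q : Tm σ Γ Δ T} (h : InSubterm DisLaw P Q) :
    Q.weight < P.weight := by
  induction h with
  | here h =>
    cases h with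
    | dis m P k hk =>
      -- With w the weight of m(X).P, the left side weighs (2i + 3)w and the right side (i + 2)w,
      -- where w is positive.
      obtain ⟨i, rfl⟩ : ∃ i, k = i + 2 := ⟨k - 2, by omega⟩
      simp only [Tm.weight, Tm.weight_copies, Tm.wkP, Tm.weight_ren]
      rw [show i + 2 - 1 = i + 1 by omega]
      nlinarith
  | inp | out | parL | parR | pabs | pappL | pappR | nabs | napp =>
    simp only [Tm.weight]; omega

theorem Tm.betaNormal_copies {Γ Δ} (n : ℕ) {P : Tm σ Γ Δ .proc} (h : P.BetaNormal) :
    (Tm.copies n P).BetaNormal := by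
  induction n with
  | zero => trivial
  | succ n ih => exact ⟨h, ih⟩

theorem isAbs_iff_of_monoidDisLaw {Γ Δ T} {P Q : Tm σ Γ Δ T} (h : Cong MonoidDisLaw P Q) :
    P.IsAbs ↔ Q.IsAbs := by
  cases h.headMatch stable_monoidDisLaw.proc with
  | proc => exact iff_of_false (Tm.not_isAbs_proc _) (Tm.not_isAbs_proc _)
  | var | pabs | nabs => exact Iff.rfl

/-- DIS only redistributes copies of one body, so it creates no application redex and removes none
entirely. After beta-normalization only DIS steps remain, and the weight bounds them. -/
theorem betaNormal_iff_of_monoidDisLaw {Γ Δ T} {P Q : Tm σ Γ Δ T} (h : Cong MonoidDisLaw P Q) :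
    P.BetaNormal ↔ Q.BetaNormal := by
  induction h with
  | base h =>
    rcases h with h | h
    · cases h with
      | assoc => exact and_assoc
      | comm => exact and_comm
      | unit => exact and_iff_left trivial
    · cases h with
      | dis m P k hk =>
        obtain ⟨i, rfl⟩ : ∃ i, k = i + 1 := ⟨k - 1, by omega⟩
        exact ⟨fun h => Tm.betaNormal_copies _ (P := .inp m P) h.1,
          fun h => ⟨h.1, Tm.betaNormal_copies _ (Tm.BetaNormal.ren (P := .inp m P) h.1 _ _)⟩⟩
  | refl P => exact Iff.rfl
  | symm _ ih => exact ih.symm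
  | trans _ _ ih₁ ih₂ => exact ih₁.trans ih₂
  | inp _ _ ih => exact ih
  | out _ _ ih => exact ih
  | par _ _ ih₁ ih₂ => exact and_congr ih₁ ih₂
  | pabs _ ih => exact ih
  | papp h _ _ ih => exact and_congr (not_congr (isAbs_iff_of_monoidDisLaw h)) ih
  | nabs _ ih => exact ih
  | napp _ h _ => exact not_congr (isAbs_iff_of_monoidDisLaw h)

theorem Tm.BetaNormal.inSubterm_disLaw {Γ Δ T} {P Q : Tm σ Γ Δ T} (hP : P.BetaNormal)
    (h : InSubterm (fun _ _ _ A B => DisLaw A B ∨ AppLaw A B) P Q) : InSubterm DisLaw P Q := by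
  induction h with
  | here h =>
    rcases h with h | h
    · exact .here h
    · cases h with
      | app1 => exact (hP.1 trivial).elim
      | app2 => exact (hP trivial).elim
  | inp m _ ih => exact .inp m (ih hP)
  | out m _ ih => exact .out m (ih hP)
  | parL Q _ ih => exact .parL Q (ih hP.1)
  | parR P _ ih => exact .parR P (ih hP.2)
  | pabs _ ih => exact .pabs (ih hP)
  | pappL Q _ ih =>
    obtain ⟨x, rfl⟩ := Tm.eq_var_of_not_isAbs_pabs hP.1
    exact .pappL Q (ih trivial)
  | pappR P _ ih => exact .pappR P (ih hP.2)
  | nabs _ ih => exact .nabs (ih hP)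
  | napp n _ ih =>
    obtain ⟨x, rfl⟩ := Tm.eq_var_of_not_isAbs_nabs hP
    exact .napp n (ih trivial)

theorem Tm.BetaNormal.rewrites {Γ Δ T} {P Q : Tm σ Γ Δ T} (hP : P.BetaNormal)
    (h : Rewrites P Q) : Q.BetaNormal ∧ Q.weight < P.weight := by
  obtain ⟨P', Q', h₁, h₂, h₃⟩ := h
  have hM : ∀ {P Q : Tm σ Γ Δ T}, MCongr P Q → Cong MonoidDisLaw P Q := Cong.mono Or.inl
  have hP' := (betaNormal_iff_of_monoidDisLaw (hM h₁)).1 hP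
  have h₂' := hP'.inSubterm_disLaw h₂
  refine ⟨(betaNormal_iff_of_monoidDisLaw ((Cong.mono Or.inr h₂'.cong).trans (hM h₃))).1 hP', ?_⟩
  rw [h₁.weight_eq, ← h₃.weight_eq]
  exact h₂'.weight_lt

theorem InSubterm.mono {B B' : TRel σ} (hB : ∀ {Γ Δ T} {P Q : Tm σ Γ Δ T}, B P Q → B' P Q)
    {Γ Δ T} {P Q : Tm σ Γ Δ T} (h : InSubterm B P Q) : InSubterm B' P Q := by
  induction h with
  | here h => exact .here (hB h)
  | inp m _ ih => exact .inp m ih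
  | out m _ ih => exact .out m ih
  | parL Q _ ih => exact .parL Q ih
  | parR P _ ih => exact .parR P ih
  | pabs _ ih => exact .pabs ih
  | pappL Q _ ih => exact .pappL Q ih
  | pappR P _ ih => exact .pappR P ih
  | nabs _ ih => exact .nabs ih
  | napp n _ ih => exact .napp n ih

theorem Tm.BetaNormal.exists_normalFormOf {Γ Δ T} {P : Tm σ Γ Δ T} (hP : P.BetaNormal) :
    ∃ N, NormalFormOf N P := by
  induction hn : P.weight using Nat.strong_induction_on generalizing P with
  | _ n ih =>
  by_cases h : IsNormal P
  · exact ⟨P, .refl, h⟩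
  · simp only [IsNormal, not_forall, not_not] at h
    obtain ⟨Q, hQ⟩ := h
    obtain ⟨hQ', hlt⟩ := hP.rewrites hQ
    obtain ⟨N, h₁, h₂⟩ := ih _ (hn ▸ hlt) hQ' rfl
    exact ⟨N, h₁.head hQ, h₂⟩

theorem Tm.exists_normalFormOf {Γ Δ T} (P : Tm σ Γ Δ T) : ∃ N, NormalFormOf N P := by
  obtain ⟨N, h₁, h₂⟩ := P.betaNormal_bnf.exists_normalFormOf
  refine ⟨N, .trans (P.appSteps_bnf.lift id fun A B h => ?_) h₁, h₂⟩
  exact ⟨A, B, .refl _, h.mono Or.inr, .refl _⟩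

theorem Rewrites.axEq {Γ Δ T} {P Q : Tm σ Γ Δ T} (h : Rewrites P Q) : AxEq P Q := by
  obtain ⟨P', Q', h₁, h₂, h₃⟩ := h
  exact h₁.sCongr.axEq.trans ((Cong.mono Or.inr h₂.cong).trans h₃.sCongr.axEq)

theorem NormalFormOf.axEq {Γ Δ T} {N P : Tm σ Γ Δ T} (h : NormalFormOf N P) : AxEq P N := by
  have hs := h.1
  clear h
  induction hs with
  | refl => exact .refl _
  | tail _ h ih => exact ih.trans h.axEq

/-- Soundness moves bisimilarity between terms and their normal forms, where `Bisim.mCongr` applies.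
Taking both terms equal gives uniqueness of normal forms. -/
theorem NormalFormOf.bisim_iff {Γ Δ T} {P Q N M : Tm σ Γ Δ T} (hN : NormalFormOf N P)
    (hM : NormalFormOf M Q) : Bisim P Q ↔ SCongr N M :=
  ⟨fun h => (((hN.axEq.bisim.symm.trans h).trans hM.axEq.bisim).mCongr hN.2.normal
      hM.2.normal).sCongr,
    fun h => (hN.axEq.bisim.trans h.bisim).trans hM.axEq.bisim.symm⟩

theorem bisim_iff_axEq {Γ Δ T} {P Q : Tm σ Γ Δ T} : Bisim P Q ↔ AxEq P Q := by
  refine ⟨fun h => ?_, AxEq.bisim⟩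
  obtain ⟨N, hN⟩ := P.exists_normalFormOf
  obtain ⟨M, hM⟩ := Q.exists_normalFormOf
  exact hN.axEq.trans (((hN.bisim_iff hM).1 h).axEq.trans (Cong.symm hM.axEq))

end NormalForms

end HOmp

theorem mainTheorem9 (σ : HOmp.Sorting)
    (Γ : List (HOmp.Ty σ.NSort)) (Δ : List σ.NSort) (T : HOmp.Ty σ.NSort) :
    -- every term has a normal form, unique up to structural congruence
    (∀ P : HOmp.Tm σ Γ Δ T,
      (∃ N, HOmp.NormalFormOf N P) ∧
      ∀ N N', HOmp.NormalFormOf N P → HOmp.NormalFormOf N' P → HOmp.SCongr N N') ∧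
    -- soundness of rewriting and of normalization
    (∀ P Q : HOmp.Tm σ Γ Δ T, HOmp.Rewrites P Q → HOmp.Bisim P Q) ∧
    (∀ P N : HOmp.Tm σ Γ Δ T, HOmp.NormalFormOf N P → HOmp.Bisim P N) ∧
    -- completeness: bisimilar terms have structurally congruent normal forms, and conversely
    (∀ P Q N M : HOmp.Tm σ Γ Δ T, HOmp.NormalFormOf N P → HOmp.NormalFormOf M Q →
      (HOmp.Bisim P Q ↔ HOmp.SCongr N M)) ∧
    -- the axiom system is sound and complete
    (∀ P Q : HOmp.Tm σ Γ Δ T, HOmp.Bisim P Q ↔ HOmp.AxEq P Q) :=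
  ⟨fun P => ⟨P.exists_normalFormOf, fun _ _ hN hN' =>
      (hN.bisim_iff hN').1 (HOmp.AxEq.bisim (.refl P))⟩,
    fun _ _ h => h.axEq.bisim, fun _ _ h => h.axEq.bisim,
    fun _ _ _ _ hN hM => hN.bisim_iff hM, fun _ _ => HOmp.bisim_iff_axEq⟩
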